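/- Consider the points $(i,j)$, $1\le i\le h$, $1\le j\le w$, of an $h\times w$ grid. A card is an ordered pair $(p,q)$ of grid points: it has a hoop at $p$ and a ball at $q$. A finite set $\mathcal S$ of cards is a swish (without flip or rotation) if for every grid point $p$, either no card in $\mathcal S$ has a hoop at $p$ and no card in $\mathcal S$ has a ball at $p$, or exactly one card in $\mathcal S$ has a hoop at $p$ and exactly one card in $\mathcal S$ has a ball at $p$. The problem Swish without Flip or Rotation is: given $h$, $w$, a set $\mathcal C$ of cards on the $h\times w$ grid and an integer $k$, decide whether there is a swish $\mathcal S\subseteq\mathcal C$ with $|\mathcal S|\ge k$. Theorem. Swish without Flip or Rotation is solvable in deterministic polynomial time: there are a single algorithm (a program for a random access machine with addition and subtraction, under the logarithmic cost criterion) and a polynomial $P$ such that on every instance, given as the list of the integers $h$, $w$, $k$ and the coordinates of the cards in any order, the algorithm halts with the correct answer within cost $P(N)$, where $N$ is the total length of these integers written in binary (with one sign symbol each). -/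

import Mathlib

/-! ### A random access machine with logarithmic cost -/

/-- A state of the machine: registers `reg 0, reg 1, …` (a fixed program mentions only finitely
many of them) and a random access memory, all holding integers. -/
structure RAMState where
  reg : ℕ → ℤ
  mem : ℤ → ℤ

/-- Structured programs for the random access machine. There is no multiplication. -/
inductive RAMProg : Type
  | skip : RAMProg
  /-- `const r z` is `reg r := z`. -/
  | const (r : ℕ) (z : ℤ) : RAMProg
  /-- `add r a b` is `reg r := reg a + reg b`. -/
  | add (r a b : ℕ) : RAMProg
  /-- `sub r a b` is `reg r := reg a - reg b`. -/
  | sub (r a b : ℕ) : RAMProg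
  /-- `load r a` is `reg r := mem (reg a)`. -/
  | load (r a : ℕ) : RAMProg
  /-- `store a b` is `mem (reg a) := reg b`. -/
  | store (a b : ℕ) : RAMProg
  | seq (P Q : RAMProg) : RAMProg
  /-- `ifPos r P Q` is `if reg r > 0 then P else Q`. -/
  | ifPos (r : ℕ) (P Q : RAMProg) : RAMProg
  /-- `whilePos r P` is `while reg r > 0 do P`. -/
  | whilePos (r : ℕ) (P : RAMProg) : RAMProg

/-- The length of an integer written in binary, with one more symbol for its sign. -/
def bitLength (z : ℤ) : ℕ := Nat.size z.natAbs + 1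

namespace RAMState

/-- Overwrite one register. -/
def setReg (s : RAMState) (r : ℕ) (z : ℤ) : RAMState :=
  { s with reg := Function.update s.reg r z }

/-- Overwrite one memory cell. -/
def setMem (s : RAMState) (a : ℤ) (z : ℤ) : RAMState :=
  { s with mem := Function.update s.mem a z }

/-- The initial state on an input `x`: the entries of `x` are in the memory cells
`0, 1, …, x.length - 1`, register `0` holds `x.length`, and everything else is `0`. -/
def init (x : List ℤ) : RAMState where
  reg := fun r => if r = 0 then (x.length : ℤ) else 0
  mem := fun a => if 0 ≤ a then x.getD a.toNat 0 else 0

end RAMState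

/-- `RAMExec P s t s'`: started in the state `s`, the program `P` halts in the state `s'`, after
a computation of cost `t` under the logarithmic cost criterion (every instruction and every test is
charged the binary lengths of the numbers and of the memory addresses it handles). At most one rule
applies to a given `P` and `s`, so the machine is deterministic. -/
inductive RAMExec : RAMProg → RAMState → ℕ → RAMState → Prop
  | skip (s : RAMState) : RAMExec .skip s 1 s
  | const (s : RAMState) (r : ℕ) (z : ℤ) :
      RAMExec (.const r z) s (bitLength z) (s.setReg r z)
  | add (s : RAMState) (r a b : ℕ) :
      RAMExec (.add r a b) s (bitLength (s.reg a) + bitLength (s.reg b))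
        (s.setReg r (s.reg a + s.reg b))
  | sub (s : RAMState) (r a b : ℕ) :
      RAMExec (.sub r a b) s (bitLength (s.reg a) + bitLength (s.reg b))
        (s.setReg r (s.reg a - s.reg b))
  | load (s : RAMState) (r a : ℕ) :
      RAMExec (.load r a) s (bitLength (s.reg a) + bitLength (s.mem (s.reg a)))
        (s.setReg r (s.mem (s.reg a)))
  | store (s : RAMState) (a b : ℕ) :
      RAMExec (.store a b) s (bitLength (s.reg a) + bitLength (s.reg b))
        (s.setMem (s.reg a) (s.reg b))
  | seq {P Q : RAMProg} {s s' s'' : RAMState} {t t' : ℕ} :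
      RAMExec P s t s' → RAMExec Q s' t' s'' → RAMExec (.seq P Q) s (t + t') s''
  | ifPos_true {r : ℕ} {P Q : RAMProg} {s s' : RAMState} {t : ℕ} :
      0 < s.reg r → RAMExec P s t s' →
        RAMExec (.ifPos r P Q) s (bitLength (s.reg r) + t) s'
  | ifPos_false {r : ℕ} {P Q : RAMProg} {s s' : RAMState} {t : ℕ} :
      s.reg r ≤ 0 → RAMExec Q s t s' →
        RAMExec (.ifPos r P Q) s (bitLength (s.reg r) + t) s'
  | while_false {r : ℕ} {P : RAMProg} {s : RAMState} :
      s.reg r ≤ 0 → RAMExec (.whilePos r P) s (bitLength (s.reg r)) s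
  | while_true {r : ℕ} {P : RAMProg} {s s' s'' : RAMState} {t t' : ℕ} :
      0 < s.reg r → RAMExec P s t s' → RAMExec (.whilePos r P) s' t' s'' →
        RAMExec (.whilePos r P) s (bitLength (s.reg r) + t + t') s''

/-- The size of an input: the total binary length of its entries. -/
def inputSize (x : List ℤ) : ℕ := (x.map bitLength).sum

/-- The decision problem with instances in `α`, written down as lists of integers by `enc`, and with
the yes-instances singled out by `yes`, is solvable in (deterministic) polynomial time: one program
halts on every instance within a cost polynomial in the input size, and its answer in register `0`
is `1` on yes-instances and `0` on no-instances. -/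
def SolvableInPolyTime {α : Type*} (enc : α → List ℤ) (yes : α → Prop) : Prop :=
  ∃ (P : RAMProg) (p : Polynomial ℕ), ∀ x : α, ∃ (t : ℕ) (s : RAMState),
    RAMExec P (RAMState.init (enc x)) t s ∧
    t ≤ p.eval (inputSize (enc x)) ∧
    (yes x → s.reg 0 = 1) ∧ (¬ yes x → s.reg 0 = 0)

/-! ### The game -/

/-- The points of the `h × w` grid (numbered from `0` here, and from `1` in the input below). -/
abbrev GridPoint (h w : ℕ) : Type := Fin h × Fin w

/-- A card: the pair of the position of its hoop and the position of its ball. -/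
abbrev SwishCard (h w : ℕ) : Type := GridPoint h w × GridPoint h w

/-- `S` is a swish, every card being used as it is (no flips and no rotations). -/
def IsSwish {h w : ℕ} (S : Finset (SwishCard h w)) : Prop :=
  ∀ p : GridPoint h w,
    ((¬ ∃ c ∈ S, c.1 = p) ∧ (¬ ∃ c ∈ S, c.2 = p)) ∨
    ((∃! c, c ∈ S ∧ c.1 = p) ∧ (∃! c, c ∈ S ∧ c.2 = p))

/-- An instance of the decision problem: a set of cards on an `h × w` grid, listed in an arbitrary
order without repetition, and an integer `k`. -/
structure SwishInstance where
  h : ℕ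
  w : ℕ
  k : ℤ
  cards : List (SwishCard h w)
  nodup : cards.Nodup

namespace SwishInstance

/-- The four coordinates of a card. -/
def encodeCard {h w : ℕ} (c : SwishCard h w) : List ℤ :=
  [(c.1.1 : ℤ) + 1, (c.1.2 : ℤ) + 1, (c.2.1 : ℤ) + 1, (c.2.2 : ℤ) + 1]

/-- An instance as it is given to the machine: `h`, `w`, `k`, then the coordinates of the cards. -/
def encode (I : SwishInstance) : List ℤ :=
  [(I.h : ℤ), (I.w : ℤ), I.k] ++ I.cards.flatMap encodeCard

/-- There is a swish of size at least `k` among the given cards. -/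
def HasLargeSwish (I : SwishInstance) : Prop :=
  ∃ S : Finset (SwishCard I.h I.w),
    S ⊆ I.cards.toFinset ∧ IsSwish S ∧ I.k ≤ (S.card : ℤ)

end SwishInstance

/-! ### Bit lengths -/

/-! A swish is the arc set of vertex-disjoint directed cycles: draw each card as an arc between its
ball and its hoop, loops allowed. Completing the cycles by fixed points turns a swish into a
permutation, so finding the largest swish is an assignment problem.

Let `L` be the number of integers in the input. Every point on a card is represented by an address
below `L` where its two coordinates stand consecutively. Between these `L` nodes a card has weight
`(L+1)^2`, a diagonal entry that is not a card has weight `L(L+1)`, and everything else has weight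
`0`. A permutation that uses a zero entry weighs at most `(L-1)(L+1)^2 < L^2(L+1)`, which is less
than the identity. Any heavier permutation therefore consists of cards and fixed points, and its
weight is `L^2(L+1)` plus `L+1` times the number of its cards. Both directions are
`exists_perm_of_isSwish` and `exists_isSwish_of_perm`.

The assignment is found by an auction with unit price increments (`AuctionInv`). Each bidder holds
an object that is within `1` of its best choice at current prices, so the final assignment is
optimal up to `L` (`AuctionInv.exists_perm`). Since one card is worth `L+1`, this error does not
affect the decision (`hasLargeSwish_iff`). While a bidder is unassigned some object is still free at
price `0`, which keeps all prices at most `D+1`, where `D = (L+1)^2` bounds the weights. Hence the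
number of bids is polynomial in `L`.

For the cost, `Triple` bounds the number of steps. A step lengthens numbers by at most one bit, so
`b` steps on numbers of length `M` cost at most `2b(M+b)`. The step count depends on `L` only, not
on the size of `k` or of the coordinates. The matrix is kept at negative addresses, the prices in
`[L, 2L)` and the owners in `[2L, 3L)`, so the input in `[0, L)` is never overwritten. -/

theorem bitLength_le_iff (z : ℤ) (k : ℕ) : bitLength z ≤ k + 1 ↔ z.natAbs < 2 ^ k := by
  unfold bitLength
  rw [Nat.add_le_add_iff_right, Nat.size_le]

theorem bitLength_pos (z : ℤ) : 1 ≤ bitLength z := by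
  unfold bitLength
  omega

theorem bitLength_add_le {x y : ℤ} {M : ℕ} (hx : bitLength x ≤ M) (hy : bitLength y ≤ M) :
    bitLength (x + y) ≤ M + 1 := by
  obtain ⟨k, rfl⟩ : ∃ k, M = k + 1 := ⟨M - 1, by have := bitLength_pos x; omega⟩
  rw [bitLength_le_iff] at *
  have := Int.natAbs_add_le x y
  rw [pow_succ]
  omega

theorem bitLength_neg (x : ℤ) : bitLength (-x) = bitLength x := by
  unfold bitLength
  rw [Int.natAbs_neg]

theorem bitLength_sub_le {x y : ℤ} {M : ℕ} (hx : bitLength x ≤ M) (hy : bitLength y ≤ M) :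
    bitLength (x - y) ≤ M + 1 := by
  rw [sub_eq_add_neg]
  exact bitLength_add_le hx (by rwa [bitLength_neg])

theorem bitLength_natCast_le (n : ℕ) : bitLength (n : ℤ) ≤ n + 1 := by
  rw [bitLength_le_iff]
  simpa using Nat.lt_two_pow_self

namespace RAMState

@[simp] theorem setReg_mem (s : RAMState) (r : ℕ) (z : ℤ) : (s.setReg r z).mem = s.mem := rfl

@[simp] theorem setMem_reg (s : RAMState) (a z : ℤ) : (s.setMem a z).reg = s.reg := rfl

@[simp] theorem setReg_reg (s : RAMState) (r r' : ℕ) (z : ℤ) :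
    (s.setReg r z).reg r' = if r' = r then z else s.reg r' := by
  simp [setReg, Function.update_apply]

theorem setMem_mem (s : RAMState) (a a' z : ℤ) :
    (s.setMem a z).mem a' = if a' = a then z else s.mem a' := by
  simp [setMem, Function.update_apply]

/-- All numbers stored in the state have binary length at most `M`. -/
def Bounded (s : RAMState) (M : ℕ) : Prop :=
  (∀ r, bitLength (s.reg r) ≤ M) ∧ ∀ a, bitLength (s.mem a) ≤ M

theorem Bounded.mono {s : RAMState} {M M' : ℕ} (h : s.Bounded M) (hM : M ≤ M') : s.Bounded M' :=
  ⟨fun r => (h.1 r).trans hM, fun a => (h.2 a).trans hM⟩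

theorem Bounded.setReg {s : RAMState} {M : ℕ} (h : s.Bounded M) (r : ℕ) {z : ℤ}
    (hz : bitLength z ≤ M) : (s.setReg r z).Bounded M := by
  refine ⟨fun r' => ?_, h.2⟩
  rw [setReg_reg]
  split_ifs
  exacts [hz, h.1 r']

theorem Bounded.setMem {s : RAMState} {M : ℕ} (h : s.Bounded M) (a : ℤ) {z : ℤ}
    (hz : bitLength z ≤ M) : (s.setMem a z).Bounded M := by
  refine ⟨h.1, fun a' => ?_⟩
  rw [setMem_mem]
  split_ifs
  exacts [hz, h.2 a']

end RAMState

/-! ### A program logic counting instructions -/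

/-- Started in `s`, the program `P` halts within `b` steps in a state satisfying `Q`. A step
lengthens the numbers by at most one bit, so the number of steps controls the logarithmic cost. -/
def Triple (P : RAMProg) (s : RAMState) (b : ℕ) (Q : RAMState → Prop) : Prop :=
  ∃ t s', RAMExec P s t s' ∧ Q s' ∧
    ∀ M, s.Bounded M → s'.Bounded (M + b) ∧ t ≤ b * (2 * (M + b))

namespace Triple

variable {P P' : RAMProg} {s : RAMState} {b b' : ℕ} {Q Q' : RAMState → Prop}

theorem mono (h : Triple P s b Q) (hb : b ≤ b') (hQ : ∀ s', Q s' → Q' s') :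
    Triple P s b' Q' := by
  obtain ⟨t, s', h1, h2, h3⟩ := h
  refine ⟨t, s', h1, hQ _ h2, fun M hM => ⟨(h3 M hM).1.mono (by omega), (h3 M hM).2.trans ?_⟩⟩
  gcongr

theorem skip (h : Q s) : Triple .skip s 1 Q := by
  refine ⟨1, s, .skip s, h, fun M hM => ⟨hM.mono (by omega), ?_⟩⟩
  omega

/-- A literal can be longer than every stored number, so it is counted as `bitLength z` steps; this
preserves the bound of one extra bit per step. -/
theorem const {r : ℕ} {z : ℤ} (h : Q (s.setReg r z)) :
    Triple (.const r z) s (bitLength z) Q := by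
  refine ⟨_, _, .const s r z, h, fun M hM => ⟨?_, ?_⟩⟩
  · exact (hM.mono (by omega)).setReg r (by omega)
  · have := bitLength_pos z
    nlinarith

theorem le_two_mul_of_le {x y M : ℕ} (hx : x ≤ M) (hy : y ≤ M) : x + y ≤ 1 * (2 * (M + 1)) := by
  omega

theorem add {r a c : ℕ} (h : Q (s.setReg r (s.reg a + s.reg c))) :
    Triple (.add r a c) s 1 Q :=
  ⟨_, _, .add s r a c, h, fun M hM =>
    ⟨(hM.mono (by omega)).setReg r (bitLength_add_le (hM.1 a) (hM.1 c)),
      le_two_mul_of_le (hM.1 a) (hM.1 c)⟩⟩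

theorem sub {r a c : ℕ} (h : Q (s.setReg r (s.reg a - s.reg c))) :
    Triple (.sub r a c) s 1 Q :=
  ⟨_, _, .sub s r a c, h, fun M hM =>
    ⟨(hM.mono (by omega)).setReg r (bitLength_sub_le (hM.1 a) (hM.1 c)),
      le_two_mul_of_le (hM.1 a) (hM.1 c)⟩⟩

theorem load {r a : ℕ} (h : Q (s.setReg r (s.mem (s.reg a)))) :
    Triple (.load r a) s 1 Q :=
  ⟨_, _, .load s r a, h, fun M hM =>
    ⟨(hM.setReg r (hM.2 _)).mono (by omega), le_two_mul_of_le (hM.1 a) (hM.2 _)⟩⟩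

theorem store {a c : ℕ} (h : Q (s.setMem (s.reg a) (s.reg c))) :
    Triple (.store a c) s 1 Q :=
  ⟨_, _, .store s a c, h, fun M hM =>
    ⟨(hM.setMem _ (hM.1 c)).mono (by omega), le_two_mul_of_le (hM.1 a) (hM.1 c)⟩⟩

theorem seq (h : Triple P s b fun s' => Triple P' s' b' Q) :
    Triple (.seq P P') s (b + b') Q := by
  obtain ⟨t, s', h1, ⟨t', s'', h1', h2', h3'⟩, h3⟩ := h
  refine ⟨_, _, .seq h1 h1', h2', fun M hM => ?_⟩
  have h4 := h3 M hM
  have h5 := h3' _ h4.1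
  refine ⟨h5.1.mono (by omega), ?_⟩
  calc t + t' ≤ b * (2 * (M + b)) + b' * (2 * (M + b + b')) := Nat.add_le_add h4.2 h5.2
    _ ≤ b * (2 * (M + (b + b'))) + b' * (2 * (M + (b + b'))) :=
        Nat.add_le_add (Nat.mul_le_mul_left _ (by omega)) (Nat.mul_le_mul_left _ (by omega))
    _ = _ := by ring

theorem ifPos {r : ℕ} (h : 0 < s.reg r → Triple P s b Q) (h' : s.reg r ≤ 0 → Triple P' s b Q) :
    Triple (.ifPos r P P') s (b + 1) Q := by
  have key : ∀ {t : ℕ} {s' : RAMState}, (∀ M, s.Bounded M → s'.Bounded (M + b) ∧ t ≤ b * (2 * (M + b))) →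
      ∀ M, s.Bounded M → s'.Bounded (M + (b + 1)) ∧
        bitLength (s.reg r) + t ≤ (b + 1) * (2 * (M + (b + 1))) := by
    intro t s' h3 M hM
    refine ⟨(h3 M hM).1.mono (by omega), ?_⟩
    have h1 := (h3 M hM).2
    have h2 := hM.1 r
    nlinarith
  rcases lt_or_ge 0 (s.reg r) with h0 | h0
  · obtain ⟨t, s', h1, h2, h3⟩ := h h0
    exact ⟨_, _, .ifPos_true h0 h1, h2, key h3⟩
  · obtain ⟨t, s', h1, h2, h3⟩ := h' h0
    exact ⟨_, _, .ifPos_false h0 h1, h2, key h3⟩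

/-- The index `m` of the invariant is a variant: it drops at each round, so at most `m` rounds
occur. The summand in `b + 1` pays for the test, and the one in `m + 1` covers the last, failing
test. -/
theorem whilePos {r : ℕ} (I : ℕ → RAMState → Prop)
    (hI : ∀ m s, I m s → 0 < s.reg r → Triple P s b fun s' => ∃ m' < m, I m' s') :
    ∀ {m : ℕ} {s : RAMState}, I m s →
      Triple (.whilePos r P) s ((m + 1) * (b + 1)) fun s' => (∃ m', I m' s') ∧ s'.reg r ≤ 0 := by
  intro m
  induction m using Nat.strong_induction_on with
  | _ m ih =>
  intro s hs
  rcases lt_or_ge 0 (s.reg r) with h0 | h0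
  · obtain ⟨t, s', h1, ⟨m', hm', hs'⟩, h3⟩ := hI m s hs h0
    obtain ⟨t', s'', h1', h2', h3'⟩ := ih m' hm' hs'
    refine ⟨_, _, .while_true h0 h1 h1', h2', fun M hM => ?_⟩
    have h4 := h3 M hM
    have h5 := h3' _ h4.1
    have h6 := hM.1 r
    have h7 : (m' + 1) * (b + 1) ≤ m * (b + 1) := by gcongr; omega
    have h8 : (m + 1) * (b + 1) = m * (b + 1) + (b + 1) := by ring
    refine ⟨h5.1.mono (by omega), ?_⟩
    set x := (m' + 1) * (b + 1)
    set y := m * (b + 1)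
    calc bitLength (s.reg r) + t + t' ≤ M + b * (2 * (M + b)) + x * (2 * (M + b + x)) :=
        Nat.add_le_add (Nat.add_le_add h6 h4.2) h5.2
      _ ≤ 2 * (M + ((m + 1) * (b + 1))) + b * (2 * (M + ((m + 1) * (b + 1))))
          + y * (2 * (M + ((m + 1) * (b + 1)))) :=
        Nat.add_le_add (Nat.add_le_add (by omega) (Nat.mul_le_mul_left _ (by omega)))
          (Nat.mul_le_mul h7 (by omega))
      _ = (y + (b + 1)) * (2 * (M + ((m + 1) * (b + 1)))) := by ring
      _ = _ := by rw [h8]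
  · refine ⟨_, _, .while_false h0, ⟨⟨m, hs⟩, h0⟩, fun M hM => ⟨hM.mono (by omega), ?_⟩⟩
    have h6 := hM.1 r
    have h8 : 1 ≤ (m + 1) * (b + 1) := Nat.mul_pos (by omega) (by omega)
    calc bitLength (s.reg r) ≤ 1 * (2 * (M + (m + 1) * (b + 1))) := by omega
      _ ≤ _ := by gcongr

/-- The rule for loops that run exactly `m` times. -/
theorem whilePos_iterate {r : ℕ} (m : ℕ) (I : ℕ → RAMState → Prop)
    (hr : ∀ i ≤ m, ∀ s, I i s → (0 < s.reg r ↔ i < m))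
    (hI : ∀ i < m, ∀ s, I i s → Triple P s b (I (i + 1))) (hs : I 0 s) :
    Triple (.whilePos r P) s ((m + 1) * (b + 1)) (I m) := by
  refine (whilePos (b := b) (fun k s => k ≤ m ∧ I (m - k) s) ?_ (m := m) (s := s) ?_).mono
    le_rfl ?_
  · rintro k s ⟨hk, hs⟩ h0
    have := (hr _ (by omega) _ hs).mp h0
    refine (hI (m - k) (by omega) s hs).mono le_rfl fun s' hs' => ⟨k - 1, by omega, by omega, ?_⟩
    rwa [show m - (k - 1) = m - k + 1 by omega]
  · exact ⟨le_rfl, by simpa using hs⟩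
  · rintro s ⟨⟨k, hk, hs⟩, h0⟩
    have := hr _ (by omega) _ hs
    obtain rfl : k = 0 := by omega
    simpa using hs

/-- The rule for loops that run exactly as often as the counter in register `r` says. -/
theorem whilePos_count {r : ℕ} (m : ℕ) (I : ℕ → RAMState → Prop)
    (hr : ∀ i ≤ m, ∀ s, I i s → s.reg r = ((m - i : ℕ) : ℤ))
    (hI : ∀ i < m, ∀ s, I i s → Triple P s b (I (i + 1))) (hs : I 0 s) :
    Triple (.whilePos r P) s ((m + 1) * (b + 1)) (I m) :=
  whilePos_iterate m I (fun i hi s hs => by rw [hr i hi s hs]; omega) hI hs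

theorem seq_const {r : ℕ} {z : ℤ} (h : Triple P (s.setReg r z) b Q) :
    Triple (.seq (.const r z) P) s (bitLength z + b) Q := seq (const h)

theorem seq_add {r a c : ℕ} (h : Triple P (s.setReg r (s.reg a + s.reg c)) b Q) :
    Triple (.seq (.add r a c) P) s (1 + b) Q := seq (add h)

theorem seq_sub {r a c : ℕ} (h : Triple P (s.setReg r (s.reg a - s.reg c)) b Q) :
    Triple (.seq (.sub r a c) P) s (1 + b) Q := seq (sub h)

theorem seq_load {r a : ℕ} (h : Triple P (s.setReg r (s.mem (s.reg a))) b Q) :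
    Triple (.seq (.load r a) P) s (1 + b) Q := seq (load h)

theorem seq_store {a c : ℕ} (h : Triple P (s.setMem (s.reg a) (s.reg c)) b Q) :
    Triple (.seq (.store a c) P) s (1 + b) Q := seq (store h)

end Triple

namespace RAMProg

/-- `ifEq d a c P` executes `P` if registers `a` and `c` agree; register `d` is overwritten. -/
def ifEq (d a c : ℕ) (P : RAMProg) : RAMProg :=
  .seq (.sub d a c) (.ifPos d .skip (.seq (.sub d c a) (.ifPos d .skip P)))

end RAMProg

theorem Triple.ifEq {d a c : ℕ} {P : RAMProg} {s : RAMState} {b : ℕ} {Q : RAMState → Prop}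
    (had : a ≠ d) (hcd : c ≠ d) (hb : 1 ≤ b)
    (h : s.reg a = s.reg c → ∀ z z', Triple P ((s.setReg d z).setReg d z') b Q)
    (h' : s.reg a ≠ s.reg c → ∀ z, Q (s.setReg d z) ∧ ∀ z', Q ((s.setReg d z).setReg d z')) :
    Triple (.ifEq d a c P) s (b + 4) Q := by
  refine Triple.mono (b := 1 + ((1 + (b + 1)) + 1)) (Triple.seq_sub (Triple.ifPos (fun h0 => ?_)
    fun h0 => Triple.seq_sub (Triple.ifPos (fun h1 => ?_) fun h1 => ?_))) (by omega) fun _ h => h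
  · refine (Triple.skip ?_).mono (b := 1) (by omega) fun _ h => h
    simp only [RAMState.setReg_reg, if_true] at h0
    exact (h' (by omega) _).1
  · refine (Triple.skip ?_).mono (b := 1) (by omega) fun _ h => h
    simp only [RAMState.setReg_reg, if_true, had, hcd, if_false] at h1
    exact (h' (by omega) _).2 _
  · simp only [RAMState.setReg_reg, if_true, had, hcd, if_false] at h0 h1
    exact h (by omega) _ _

infixr:60 " ⨟ " => RAMProg.seq

/-! ### Subroutines -/

/-- The memory address of the matrix entry in row `l` and column `j`. -/
def matrixAddress (L l j : ℕ) : ℤ := -1 - ((l : ℤ) * L + j)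

theorem matrixAddress_neg (L l j : ℕ) : matrixAddress L l j < 0 := by
  unfold matrixAddress
  have : (0 : ℤ) ≤ (l : ℤ) * L := by positivity
  omega

theorem matrixAddress_inj {L l j l' j' : ℕ} (hj : j < L) (hj' : j' < L) :
    matrixAddress L l j = matrixAddress L l' j' ↔ l = l' ∧ j = j' := by
  refine ⟨fun h => ?_, fun ⟨h, h'⟩ => by rw [h, h']⟩
  have h1 : l * L + j = l' * L + j' := by
    unfold matrixAddress at h
    zify
    linarith
  have hL : 0 < L := by omega
  have h2 := congrArg (· / L) h1
  have h3 := congrArg (· % L) h1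
  simp only [mul_comm _ L, Nat.mul_add_div hL, Nat.mul_add_mod, Nat.div_eq_of_lt hj,
    Nat.div_eq_of_lt hj', Nat.mod_eq_of_lt hj, Nat.mod_eq_of_lt hj', add_zero] at h2 h3
  exact ⟨h2, h3⟩

/-- Put the address of the matrix entry in row `reg 20` and column `reg 21` into `reg 22`. -/
def addressProg : RAMProg :=
  .const 22 (-1) ⨟ .sub 22 22 21 ⨟ .whilePos 20 (.sub 22 22 0 ⨟ .sub 20 20 1)

theorem triple_addressProg {s : RAMState} {L l j : ℕ} (h0 : s.reg 0 = L) (h1 : s.reg 1 = 1)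
    (h20 : s.reg 20 = l) (h21 : s.reg 21 = j) (hl : l ≤ L) :
    Triple addressProg s (3 * L + 6) fun s' =>
      s'.mem = s.mem ∧ (∀ r < 20, s'.reg r = s.reg r) ∧ s'.reg 22 = matrixAddress L l j := by
  refine Triple.mono (b := 2 + (1 + (l + 1) * (2 + 1))) (Triple.seq_const (Triple.seq_sub
    ((Triple.whilePos_count l (fun i s' => s'.mem = s.mem ∧ (∀ r < 20, s'.reg r = s.reg r) ∧
      s'.reg 20 = ((l - i : ℕ) : ℤ) ∧ s'.reg 22 = matrixAddress L i j) (fun i _ s hs => hs.2.2.1)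
      (fun i hi s' hs' => ?_) ?_).mono le_rfl ?_))) (by omega) fun _ h => h
  · obtain ⟨hm, hr, h20', h22⟩ := hs'
    refine Triple.seq_sub (b := 1) (Triple.sub ?_)
    refine ⟨by simpa using hm, fun r hr' => ?_, ?_, ?_⟩
    · have := hr r hr'
      simp [this, show r ≠ 22 by omega, show r ≠ 20 by omega]
    · simp [h20', hr 1, h1]
      omega
    · simp [h22, hr 0, h0, matrixAddress]
      ring
  · refine ⟨by simp, fun r hr => ?_, ?_, ?_⟩
    · simp [show r ≠ 22 by omega]
    · simp [h20]
    · simp [h21, matrixAddress]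
  · exact fun s' hs' => ⟨hs'.1, hs'.2.1, hs'.2.2.2⟩

/-! ### Numbering grid points by memory addresses -/

/-- An index below `t` where the values `p, q` are found in consecutive memory cells. -/
def findIdx (mem : ℤ → ℤ) (p q : ℤ) : ℕ → ℕ
  | 0 => 0
  | t + 1 => if mem t = p ∧ mem (t + 1) = q then t else findIdx mem p q t

/-- The match found need not be aligned with a card: it may straddle two points or lie in the
header. This is harmless, because equal points get equal indices and the two values at the index
determine the point. -/
theorem findIdx_spec {mem : ℤ → ℤ} {p q : ℤ} {a t : ℕ} (ha : a < t)
    (hp : mem a = p) (hq : mem (a + 1) = q) :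
    findIdx mem p q t < t ∧ mem (findIdx mem p q t) = p ∧ mem (findIdx mem p q t + 1) = q := by
  induction t with
  | zero => omega
  | succ t ih =>
    rw [findIdx]
    split_ifs with h
    · exact ⟨by omega, h⟩
    · have : a ≠ t := by
        rintro rfl
        exact h ⟨hp, hq⟩
      have := ih (by omega)
      exact ⟨by omega, this.2⟩

theorem findIdx_lt (mem : ℤ → ℤ) (p q : ℤ) {t : ℕ} (ht : 0 < t) : findIdx mem p q t < t := by
  induction t with
  | zero => omega
  | succ t ih =>
    rw [findIdx]
    split_ifs
    · omega
    · rcases Nat.eq_zero_or_pos t with rfl | h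
      · exact Nat.one_pos
      · exact (ih h).trans (Nat.lt_succ_self t)

/-- Only nonnegative addresses are searched, so filling the matrix at negative addresses leaves the
numbering unchanged. -/
theorem findIdx_congr {mem mem' : ℤ → ℤ} (h : ∀ a, 0 ≤ a → mem a = mem' a) (p q : ℤ) (t : ℕ) :
    findIdx mem p q t = findIdx mem' p q t := by
  induction t with
  | zero => rfl
  | succ t ih => rw [findIdx, findIdx, ih, h _ (by omega), h _ (by omega)]

/-- Put an index below `reg 0` where the values of `reg 10`, `reg 11` are found in consecutive
memory cells into `reg 12`. -/
def findProg : RAMProg :=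
  .const 12 0 ⨟ .const 13 0 ⨟ .add 14 0 13 ⨟ .whilePos 14
    (.load 15 13 ⨟ .add 16 13 1 ⨟ .load 16 16 ⨟
      .ifEq 17 15 10 (.ifEq 17 16 11 (.const 17 0 ⨟ .add 12 13 17)) ⨟
      .add 13 13 1 ⨟ .sub 14 14 1)

theorem triple_findProg {s : RAMState} {L : ℕ} (h0 : s.reg 0 = L) (h1 : s.reg 1 = 1) :
    Triple findProg s (16 * L + 19) fun s' =>
      s'.mem = s.mem ∧ (∀ r < 10, s'.reg r = s.reg r) ∧
        s'.reg 12 = findIdx s.mem (s.reg 10) (s.reg 11) L := by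
  have hb : bitLength 0 = 1 := by simp [bitLength]
  refine Triple.mono (b := bitLength 0 + (bitLength 0 + (1 + (L + 1) * (15 + 1))))
    (Triple.seq_const (Triple.seq_const (Triple.seq_add
    ((Triple.whilePos_count L (fun i s' => s'.mem = s.mem ∧ (∀ r < 12, s'.reg r = s.reg r) ∧
      s'.reg 14 = ((L - i : ℕ) : ℤ) ∧ s'.reg 13 = i ∧
      s'.reg 12 = findIdx s.mem (s.reg 10) (s.reg 11) i) (fun i _ s hs => hs.2.2.1)
      (fun i hi s' hs' => ?_) ?_).mono le_rfl ?_)))) (by rw [hb]; omega) fun _ h => h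
  · obtain ⟨hm, hr, h14, h13, h12⟩ := hs'
    refine Triple.mono (b := 1 + (1 + (1 + (10 + (1 + 1))))) (Triple.seq_load (Triple.seq_add
      (Triple.seq_load (Triple.seq (Triple.mono (Q := fun s'' => s''.mem = s.mem ∧
        (∀ r < 12, s''.reg r = s.reg r) ∧ s''.reg 14 = ((L - i : ℕ) : ℤ) ∧ s''.reg 13 = i ∧
        s''.reg 12 = findIdx s.mem (s.reg 10) (s.reg 11) (i + 1))
        (Triple.ifEq (b := 6) (by decide) (by decide) (by decide) ?_ ?_) le_rfl ?_)))))
        (by omega) fun _ h => h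
    · intro he z z'
      refine Triple.ifEq (b := 2) (by decide) (by decide) (by decide) ?_ ?_
      · intro he' z'' z'''
        refine Triple.mono (b := bitLength 0 + 1) (Triple.seq_const (Triple.add ?_))
          (by rw [hb]) fun _ h => h
        simp [hm, hr 10, hr 11, hr 1, h13, h1] at he he'
        refine ⟨by simp [hm], fun r hr' => ?_, by simp [h14], by simp [h13], ?_⟩
        · simp [hr r hr', show r ≠ 12 by omega, show r ≠ 17 by omega, show r ≠ 16 by omega,
            show r ≠ 15 by omega]
        · simp [h13, findIdx, he, he']
      · intro he'
        have key : findIdx s.mem (s.reg 10) (s.reg 11) (i + 1) =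
            findIdx s.mem (s.reg 10) (s.reg 11) i := by
          simp [hm, hr 10, hr 11, hr 1, h13, h1] at he he'
          simp [findIdx, he']
        refine fun z'' => ⟨?_, fun z''' => ?_⟩ <;>
        · refine ⟨by simp [hm], fun r hr' => ?_, by simp [h14], by simp [h13], ?_⟩
          · simp [hr r hr', show r ≠ 17 by omega, show r ≠ 16 by omega,
              show r ≠ 15 by omega]
          · simp [h12, key]
    · intro he
      have key : findIdx s.mem (s.reg 10) (s.reg 11) (i + 1) =
          findIdx s.mem (s.reg 10) (s.reg 11) i := by
        simp [hm, hr 10, hr 1, h13, h1] at he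
        simp [findIdx, he]
      refine fun z'' => ⟨?_, fun z''' => ?_⟩ <;>
      · refine ⟨by simp [hm], fun r hr' => ?_, by simp [h14], by simp [h13], ?_⟩
        · simp [hr r hr', show r ≠ 17 by omega, show r ≠ 16 by omega,
            show r ≠ 15 by omega]
        · simp [h12, key]
    · rintro s'' ⟨hm, hr, h14, h13, h12⟩
      refine Triple.seq_add (Triple.sub ?_)
      refine ⟨by simp [hm], fun r hr' => ?_, ?_, ?_, ?_⟩
      · simp [hr r hr', show r ≠ 14 by omega, show r ≠ 13 by omega]
      · simp [h14, hr 1, h1]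
        omega
      · simp [h13, hr 1, h1]
      · simp [h12]
  · refine ⟨by simp, fun r hr => ?_, ?_, ?_, ?_⟩
    · simp [show r ≠ 14 by omega, show r ≠ 13 by omega, show r ≠ 12 by omega]
    · simp [h0]
    · simp
    · simp [findIdx]
  · exact fun s' hs' => ⟨hs'.1, fun r hr => hs'.2.1 r (by omega), hs'.2.2.2.2⟩

/-! ### The auction algorithm for the assignment problem -/

/-- The invariant of the auction with benefits `A l j` of the bidders `l ∈ [1, L]` for the objects
`j < L`, while the bidders `l ≥ i` take part: the object `j` belongs to `own j` (to nobody if this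
is `0`) at `price j`, and the bidder `cur` is the only one without an object (none is, if this is
`0`). -/
structure AuctionInv (A : ℕ → ℕ → ℤ) (D L i cur : ℕ) (price : ℕ → ℤ) (own : ℕ → ℕ) : Prop where
  own_le : ∀ j < L, own j ≤ L
  price_nonneg : ∀ j < L, 0 ≤ price j
  price_le : ∀ j < L, price j ≤ D + 1
  price_zero : ∀ j < L, own j = 0 → price j = 0
  inj : ∀ j < L, ∀ j' < L, own j = own j' → own j ≠ 0 → j = j'
  cur_ne : ∀ j < L, own j = cur → cur = 0
  own_ge : ∀ j < L, own j ≠ 0 → i ≤ own j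
  cur_ge : cur ≠ 0 → i ≤ cur
  cur_le : cur ≤ L
  cover : ∀ l, i ≤ l → l ≤ L → l = cur ∨ ∃ j < L, own j = l
  slack : ∀ j < L, own j ≠ 0 → ∀ j' < L, A (own j) j' - price j' ≤ A (own j) j - price j + 1

namespace AuctionInv

variable {A : ℕ → ℕ → ℤ} {D L i cur : ℕ} {price : ℕ → ℤ} {own : ℕ → ℕ}

theorem start : AuctionInv A D L (L + 1) 0 (fun _ => 0) (fun _ => 0) where
  own_le := by simp
  price_nonneg := by simp
  price_le := fun _ _ => by positivity
  price_zero := by simp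
  inj := by simp
  cur_ne := by simp
  own_ge := by simp
  cur_ge := by simp
  cur_le := by simp
  cover := fun l h h' => by omega
  slack := by simp

theorem next (h : AuctionInv A D L (i + 1) 0 price own) (hi : i ≤ L) :
    AuctionInv A D L i i price own where
  own_le := h.own_le
  price_nonneg := h.price_nonneg
  price_le := h.price_le
  price_zero := h.price_zero
  inj := h.inj
  cur_ne := fun j hj hji => by
    have := h.own_ge j hj
    omega
  own_ge := fun j hj hj0 => (Nat.le_succ i).trans (h.own_ge j hj hj0)
  cur_ge := fun _ => le_rfl
  cur_le := hi
  cover := fun l hl hl' => by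
    rcases eq_or_ne l i with rfl | hli
    · exact Or.inl rfl
    · exact (h.cover l (by omega) hl').elim (fun h0 => by omega) Or.inr
  slack := h.slack

/-- Pigeonhole: if all `L` objects were owned, their owners would be `L` distinct elements of `[1,
L]` other than `cur`. -/
theorem exists_free (h : AuctionInv A D L i cur price own) (hcur : cur ≠ 0) :
    ∃ j < L, own j = 0 := by
  by_contra! hne
  have hcard := Finset.card_le_card_of_injOn (s := Finset.range L)
    (t := (Finset.Icc 1 L).erase cur) own
    (fun j hj => by
      have hj : j < L := by simpa using hj
      have h1 := h.own_le j hj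
      have h2 := hne j hj
      have h3 := h.cur_ne j hj
      simp only [Finset.coe_erase, Finset.coe_Icc, Set.mem_sdiff, Set.mem_Icc,
        Set.mem_singleton_iff]
      exact ⟨by omega, fun h4 => hcur (h3 h4)⟩)
    (fun j hj j' hj' hjj => h.inj j (by simpa using hj) j' (by simpa using hj') hjj
      (hne j (by simpa using hj)))
  have h1 := h.cur_le
  rw [Finset.card_erase_of_mem (by simp; omega)] at hcard
  simp at hcard
  omega

/-- The bidder `cur` takes its favourite object `b` at a price raised by `1`, and the displaced
owner (or `0`) becomes the new `cur`. Other owners stay satisfied because prices only rise. -/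
theorem bid (h : AuctionInv A D L i cur price own) (hcur : cur ≠ 0)
    (hA : ∀ j < L, 0 ≤ A cur j ∧ A cur j ≤ D) {b : ℕ} (hb : b < L)
    (hmax : ∀ j < L, A cur j - price j ≤ A cur b - price b) :
    price b ≤ D ∧ AuctionInv A D L i (own b) (Function.update price b (price b + 1))
      (Function.update own b cur) := by
  -- A free object has price `0` and benefit at least `0`, so the best net value is nonnegative and
  -- `price b` is at most the benefit of `b`.
  have hpb : price b ≤ D := by
    obtain ⟨j, hj, hj0⟩ := h.exists_free hcur
    have h1 := hmax j hj
    have h2 := h.price_zero j hj hj0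
    have h3 := hA j hj
    have h4 := hA b hb
    omega
  have hup : ∀ j, price j ≤ Function.update price b (price b + 1) j := fun j => by
    rw [Function.update_apply]
    split_ifs with hj
    · rw [hj]
      omega
    · exact le_rfl
  refine ⟨hpb, ?_, ?_, ?_, ?_, ?_, ?_, ?_, ?_, ?_, ?_, ?_⟩
  · intro j hj
    have := h.own_le j hj
    have := h.cur_le
    rw [Function.update_apply]
    split_ifs <;> assumption
  · exact fun j hj => (h.price_nonneg j hj).trans (hup j)
  · intro j hj
    have := h.price_le j hj
    rw [Function.update_apply]
    split_ifs
    · omega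
    · assumption
  · intro j hj
    have := h.price_zero j hj
    rw [Function.update_apply, Function.update_apply]
    split_ifs
    · exact fun h0 => absurd h0 hcur
    · assumption
  · intro j hj j' hj'
    have h1 := h.inj j hj j' hj'
    have h2 := h.cur_ne j hj
    have h3 := h.cur_ne j' hj'
    rw [Function.update_apply, Function.update_apply]
    split_ifs <;> omega
  · intro j hj
    have h1 := h.inj j hj b hb
    have h2 := h.cur_ne b hb
    rw [Function.update_apply]
    split_ifs <;> omega
  · intro j hj
    have h1 := h.own_ge j hj
    have h2 := h.cur_ge
    rw [Function.update_apply]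
    split_ifs <;> omega
  · exact h.own_ge b hb
  · exact h.own_le b hb
  · intro l hl hl'
    rcases h.cover l hl hl' with rfl | ⟨j, hj, rfl⟩
    · exact Or.inr ⟨b, hb, by simp⟩
    · rcases eq_or_ne j b with rfl | hjb
      · exact Or.inl rfl
      · exact Or.inr ⟨j, hj, by simp [hjb]⟩
  · intro j hj hj0 j' hj'
    have h1 := hup j'
    rcases eq_or_ne j b with rfl | hjb
    -- The object was optimal before its price rose by `1`, which is exactly the tolerance in
    -- `slack`.
    · simp only [Function.update_self]
      have := hmax j' hj'
      omega
    · simp only [Function.update_of_ne hjb] at hj0 ⊢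
      have := h.slack j hj hj0 j' hj'
      omega

/-- At the end of the auction, the assignment found is optimal up to `L`. -/
theorem exists_perm (h : AuctionInv A D L 1 0 price own) :
    ∃ τ : Equiv.Perm (Fin L), (∀ j : Fin L, own j = τ j + 1) ∧
      ∀ σ : Equiv.Perm (Fin L), ∑ j, A (σ j + 1) j ≤ ∑ j, A (τ j + 1) j + L := by
  have hsurj : ∀ l : Fin L, ∃ j : Fin L, own j = l + 1 := fun l => by
    rcases h.cover (l + 1) (by omega) (by omega) with h0 | ⟨j, hj, hjl⟩
    · omega
    · exact ⟨⟨j, hj⟩, hjl⟩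
  choose f hf using hsurj
  have hinj : Function.Injective f := fun l l' hll => by
    have h1 := hf l
    have h2 := hf l'
    rw [hll] at h1
    exact Fin.ext (by omega)
  let π : Equiv.Perm (Fin L) := Equiv.ofBijective f (Finite.injective_iff_bijective.mp hinj)
  have hπ : ∀ l, own (π l) = l + 1 := hf
  have hπ' : ∀ j : Fin L, own j = π.symm j + 1 := fun j => by rw [← hπ, Equiv.apply_symm_apply]
  refine ⟨π.symm, hπ', fun σ => ?_⟩
  -- Linear programming duality: under `σ` every bidder does at most `1` better, net of prices, than
  -- with its own object. Each price occurs once on both sides and cancels, leaving the error `L`.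
  have key : ∑ j, (A (σ j + 1) j - price j) ≤ ∑ j, (A (π.symm j + 1) j - price j + 1) := by
    rw [← Equiv.sum_comp (σ.trans π) fun j => A (π.symm j + 1) j - price j + 1]
    refine Finset.sum_le_sum fun j _ => ?_
    have := h.slack (π (σ j)) (by omega) (by rw [hπ]; omega) j (by omega)
    rw [hπ] at this
    simpa using this
  simp only [Finset.sum_add_distrib, Finset.sum_sub_distrib] at key
  simp at key
  linarith

end AuctionInv

/-! ### The auction on the machine -/

/-- Put the best object for the bidder `reg 5` into `reg 13`. -/
def bestProg : RAMProg :=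
  .add 20 5 6 ⨟ .add 21 6 6 ⨟ addressProg ⨟ .add 10 22 6 ⨟ .add 11 0 6 ⨟
  .load 12 10 ⨟ .load 13 11 ⨟ .sub 12 12 13 ⨟ .add 13 6 6 ⨟ .add 14 6 6 ⨟ .add 15 0 6 ⨟
  .whilePos 15 (.load 16 10 ⨟ .load 17 11 ⨟ .sub 16 16 17 ⨟ .sub 17 16 12 ⨟
    .ifPos 17 (.add 12 16 6 ⨟ .add 13 14 6) .skip ⨟
    .add 14 14 1 ⨟ .sub 10 10 1 ⨟ .add 11 11 1 ⨟ .sub 15 15 1)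

theorem triple_bestProg {s : RAMState} {L cur : ℕ} (h0 : s.reg 0 = L) (h1 : s.reg 1 = 1)
    (h6 : s.reg 6 = 0) (h5 : s.reg 5 = cur) (hcur : cur ≤ L) (hL : 0 < L) :
    Triple bestProg s (15 * L + 28) fun s' =>
      s'.mem = s.mem ∧ (∀ r < 10, s'.reg r = s.reg r) ∧ ∃ b < L, s'.reg 13 = b ∧
        ∀ j < L, s.mem (matrixAddress L cur j) - s.mem (L + j) ≤
          s.mem (matrixAddress L cur b) - s.mem (L + b) := by
  refine Triple.mono (b := 1 + (1 + ((3 * L + 6) + (1 + (1 + (1 + (1 + (1 + (1 + (1 + (1 +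
    (L + 1) * (11 + 1)))))))))))) (Triple.seq_add (Triple.seq_add (Triple.seq
    ((triple_addressProg (L := L) (l := cur) (j := 0) (by simp [h0]) (by simp [h1])
      (by simp [h5, h6]) (by simp [h6]) hcur).mono le_rfl ?_)))) (by omega) fun _ h => h
  rintro s₁ ⟨hm, hr, h22⟩
  replace hr : ∀ r < 10, s₁.reg r = s.reg r := fun r hr' => by
    rw [hr r (by omega)]
    simp [show r ≠ 21 by omega, show r ≠ 20 by omega]
  simp only [RAMState.setReg_mem] at hm
  refine Triple.seq_add (Triple.seq_add (Triple.seq_load (Triple.seq_load (Triple.seq_sub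
    (Triple.seq_add (Triple.seq_add (Triple.seq_add
    ((Triple.whilePos_count L (fun i s' => s'.mem = s.mem ∧ (∀ r < 10, s'.reg r = s.reg r) ∧
      s'.reg 15 = ((L - i : ℕ) : ℤ) ∧ s'.reg 14 = i ∧ s'.reg 10 = matrixAddress L cur i ∧
      s'.reg 11 = L + i ∧ ∃ b < L, s'.reg 13 = b ∧
        s'.reg 12 = s.mem (matrixAddress L cur b) - s.mem (L + b) ∧
        ∀ j < i, s.mem (matrixAddress L cur j) - s.mem (L + j) ≤
          s.mem (matrixAddress L cur b) - s.mem (L + b)) (fun i _ s hs => hs.2.2.1)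
      (fun i hi s' hs' => ?_) ?_).mono le_rfl ?_))))))))
  · obtain ⟨hm, hr, h15, h14, h10, h11, b, hb, h13, h12, hmax⟩ := hs'
    refine Triple.mono (b := 1 + (1 + (1 + (1 + (((1 + 1) + 1) + (1 + (1 + (1 + 1))))))))
      (Triple.seq_load (Triple.seq_load (Triple.seq_sub (Triple.seq_sub (Triple.seq
      (Triple.mono (Q := fun s'' => s''.mem = s.mem ∧ (∀ r < 10, s''.reg r = s.reg r) ∧
      s''.reg 15 = ((L - i : ℕ) : ℤ) ∧ s''.reg 14 = i ∧ s''.reg 10 = matrixAddress L cur i ∧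
      s''.reg 11 = L + i ∧ ∃ b < L, s''.reg 13 = b ∧
        s''.reg 12 = s.mem (matrixAddress L cur b) - s.mem (L + b) ∧
        ∀ j < i + 1, s.mem (matrixAddress L cur j) - s.mem (L + j) ≤
          s.mem (matrixAddress L cur b) - s.mem (L + b)) (Triple.ifPos ?_ ?_) le_rfl ?_))))))
        (by omega) fun _ h => h
    · intro hpos
      refine Triple.seq_add (Triple.add ?_)
      simp [h10, h11, h12, hm] at hpos
      refine ⟨by simp [hm], fun r hr' => ?_, by simp [h15], by simp [h14], by simp [h10],
        by simp [h11], i, hi, by simp [h14, hr, h6], by simp [h10, h11, hr, h6, hm], ?_⟩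
      · simp [hr r hr', show r ≠ 13 by omega, show r ≠ 12 by omega, show r ≠ 17 by omega,
          show r ≠ 16 by omega]
      · intro j hj
        rcases Nat.lt_succ_iff_lt_or_eq.mp hj with hj | rfl
        · have := hmax j hj
          omega
        · exact le_rfl
    · intro hpos
      refine (Triple.skip ?_).mono (b' := 1 + 1) (by omega) fun _ h => h
      simp [h10, h11, h12, hm] at hpos
      refine ⟨by simp [hm], fun r hr' => ?_, by simp [h15], by simp [h14], by simp [h10],
        by simp [h11], b, hb, by simp [h13], by simp [h12], ?_⟩
      · simp [hr r hr', show r ≠ 17 by omega, show r ≠ 16 by omega]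
      · intro j hj
        rcases Nat.lt_succ_iff_lt_or_eq.mp hj with hj | rfl
        · exact hmax j hj
        · omega
    · rintro s'' ⟨hm, hr, h15, h14, h10, h11, b, hb, h13, h12, hmax⟩
      refine Triple.seq_add (Triple.seq_sub (Triple.seq_add (Triple.sub ?_)))
      refine ⟨by simp [hm], fun r hr' => ?_, ?_, ?_, ?_, ?_, b, hb, by simp [h13],
        by simp [h12], hmax⟩
      · simp [hr r hr', show r ≠ 15 by omega, show r ≠ 11 by omega, show r ≠ 10 by omega,
          show r ≠ 14 by omega]
      · simp [h15, hr, h1]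
        omega
      · simp [h14, hr, h1]
      · simp [h10, hr, h1, matrixAddress]
        ring
      · simp [h11, hr, h1]
        ring
  · refine ⟨by simp [hm], fun r hr' => ?_, ?_, ?_, ?_, ?_, 0, hL, ?_, ?_, by simp⟩
    · simp [hr r hr', show r ≠ 15 by omega, show r ≠ 11 by omega, show r ≠ 10 by omega,
          show r ≠ 14 by omega, show r ≠ 13 by omega, show r ≠ 12 by omega]
    all_goals simp [hr, h6, h22, h0, hm]
  · rintro s' ⟨hm, hr, -, -, -, -, b, hb, h13, -, hmax⟩
    exact ⟨hm, hr, b, hb, h13, hmax⟩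

/-- The bidder `reg 5` takes its best object from the previous owner, who is put into `reg 5`. -/
def bidProg : RAMProg :=
  bestProg ⨟ .add 13 13 0 ⨟ .load 16 13 ⨟ .add 16 16 1 ⨟ .store 13 16 ⨟
  .add 13 13 0 ⨟ .load 16 13 ⨟ .store 13 5 ⨟ .add 5 16 6

/-- The bidders `reg 0, …, 1` enter the auction one after the other. -/
def auctionProg : RAMProg :=
  .const 6 0 ⨟ .add 4 0 6 ⨟ .whilePos 4 (.add 5 4 6 ⨟ .whilePos 5 bidProg ⨟ .sub 4 4 1)

/-- The state of the auction started from `s₀`, with the prices and the owners of the objects in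
the memory. -/
def AuctionState (s₀ : RAMState) (L : ℕ) (price : ℕ → ℤ) (own : ℕ → ℕ) (s : RAMState) : Prop :=
  (∀ r < 4, s.reg r = s₀.reg r) ∧ s.reg 6 = 0 ∧ (∀ a < (L : ℤ), s.mem a = s₀.mem a) ∧
    (∀ j < L, s.mem (L + j) = price j) ∧ ∀ j < L, s.mem (L + L + j) = own j

section Auction

variable {s₀ s : RAMState} {D L i cur : ℕ} {price : ℕ → ℤ} {own : ℕ → ℕ}

theorem triple_bidProg (h0 : s₀.reg 0 = L) (h1 : s₀.reg 1 = 1)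
    (hA : ∀ l ≤ L, ∀ j < L, 0 ≤ s₀.mem (matrixAddress L l j) ∧
      s₀.mem (matrixAddress L l j) ≤ D)
    (hs : AuctionState s₀ L price own s) (h5 : s.reg 5 = cur) (hcur : cur ≠ 0)
    (hinv : AuctionInv (fun l j => s₀.mem (matrixAddress L l j)) D L i cur price own) :
    Triple bidProg s (15 * L + 36) fun s' => s'.reg 4 = s.reg 4 ∧ ∃ b < L, price b ≤ D ∧
      AuctionInv (fun l j => s₀.mem (matrixAddress L l j)) D L i (own b)
        (Function.update price b (price b + 1)) (Function.update own b cur) ∧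
      AuctionState s₀ L (Function.update price b (price b + 1)) (Function.update own b cur) s' ∧
      s'.reg 5 = own b := by
  obtain ⟨hr, h6, hm, hp, ho⟩ := hs
  have hL : 0 < L := by
    have := hinv.cur_le
    omega
  refine Triple.mono (b := (15 * L + 28) + (1 + (1 + (1 + (1 + (1 + (1 + (1 + 1))))))))
    (Triple.seq ((triple_bestProg (by rw [hr 0 (by omega), h0]) (by rw [hr 1 (by omega), h1]) h6
      h5 hinv.cur_le hL).mono le_rfl ?_)) (by omega) fun _ h => h
  rintro s₁ ⟨hm₁, hr₁, b, hb, h13, hmax⟩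
  have hneg : ∀ j, matrixAddress L cur j < L := fun j => by
    have := matrixAddress_neg L cur j
    omega
  have hmax' : ∀ j < L, s₀.mem (matrixAddress L cur j) - price j ≤
      s₀.mem (matrixAddress L cur b) - price b := fun j hj => by
    have := hmax j hj
    rwa [hm _ (hneg _), hm _ (hneg _), hp j hj, hp b hb] at this
  obtain ⟨hpb, hinv'⟩ := hinv.bid hcur (hA cur hinv.cur_le) hb hmax'
  have hpb' := hp b hb
  have hob' := ho b hb
  refine Triple.seq_add (Triple.seq_load (Triple.seq_add (Triple.seq_store (Triple.seq_add
    (Triple.seq_load (Triple.seq_store (Triple.add ?_)))))))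
  have e : (b : ℤ) + L = L + b := by ring
  have e' : (L : ℤ) + b + L = L + L + b := by ring
  refine ⟨by simp [hr₁], b, hb, hpb, hinv', ⟨fun r hr' => ?_, ?_, ?_, ?_, ?_⟩, ?_⟩
  · simp [hr₁ r (by omega), hr r hr', show r ≠ 5 by omega, show r ≠ 16 by omega,
      show r ≠ 13 by omega]
  · simp [hr₁, h6]
  · intro a ha
    -- The hypothesis `ha` covers the input and the matrix; both writes go to addresses at least
    -- `L`.
    have ha' : a ≠ L + L + b := by omega
    have ha'' : a ≠ L + b := by omega
    simp [h13, hr₁, hr, h0, hm₁, e, e', RAMState.setMem_mem, ha', ha'', hm a ha]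
  · intro j hj
    have ha' : (L : ℤ) + j ≠ L + L + b := by omega
    have := hp j hj
    by_cases hjb : j = b
    · subst hjb
      simp [h13, hr₁, hr, h0, h1, hm₁, e, e', RAMState.setMem_mem, ha', hp j hj]
    · have ha'' : (L : ℤ) + j ≠ L + b := by omega
      simp [h13, hr₁, hr, h0, hm₁, e, e', RAMState.setMem_mem, ha', ha'', hp j hj, hjb]
  · intro j hj
    by_cases hjb : j = b
    · subst hjb
      simp [h13, hr₁, hr, h0, hm₁, e, e', RAMState.setMem_mem, h5]
    · have ha' : (L : ℤ) + L + j ≠ L + L + b := by omega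
      have ha'' : (L : ℤ) + L + j ≠ L + b := by omega
      simp [h13, hr₁, hr, h0, hm₁, e, e', RAMState.setMem_mem, ha'', ho j hj, hjb]
  · have ha'' : (L : ℤ) + L + b ≠ L + b := by omega
    simp [h13, hr₁, hr, h0, hm₁, e, e', RAMState.setMem_mem, ha'', h6, hob']

theorem triple_auctionProg (h0 : s₀.reg 0 = L) (h1 : s₀.reg 1 = 1)
    (hA : ∀ l ≤ L, ∀ j < L, 0 ≤ s₀.mem (matrixAddress L l j) ∧
      s₀.mem (matrixAddress L l j) ≤ D) (hm : ∀ a ≥ (L : ℤ), s₀.mem a = 0) :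
    Triple auctionProg s₀
      (2 + (L + 1) * ((L * (D + 1) + 1) * (15 * L + 37) + 3)) fun s' => ∃ price own,
      AuctionState s₀ L price own s' ∧
      AuctionInv (fun l j => s₀.mem (matrixAddress L l j)) D L 1 0 price own := by
  have hb : bitLength 0 = 1 := by simp [bitLength]
  refine Triple.mono (b := bitLength 0 + (1 + (L + 1) *
    ((1 + ((L * (D + 1) + 1) * ((15 * L + 36) + 1) + 1)) + 1))) (Triple.seq_const (Triple.seq_add
    -- Bidders enter in descending order: after `i` rounds those from `L - i + 1` upwards have
    -- entered and hold objects.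
    ((Triple.whilePos_count L (fun i s => s.reg 4 = ((L - i : ℕ) : ℤ) ∧ ∃ price own,
      AuctionState s₀ L price own s ∧
      AuctionInv (fun l j => s₀.mem (matrixAddress L l j)) D L (L - i + 1) 0 price own)
      (fun i _ s hs => hs.1) (fun i hi s hs => ?_) ?_).mono le_rfl ?_)))
    (by rw [hb]; ring_nf; omega) fun _ h => h
  · obtain ⟨h4, price, own, hs, hinv⟩ := hs
    have hinv' := hinv.next (by omega)
    refine Triple.seq_add (Triple.seq ?_)
    -- Each bid raises one price by `1`, so this potential falls by exactly `1`. Prices lie in `[0,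
    -- D + 1]`, so it lies between `0` and `L(D+1)`, which bounds the number of bids per entering
    -- bidder.
    let pot : (ℕ → ℤ) → ℤ := fun price => ∑ j ∈ Finset.range L, (D + 1 - price j)
    let I : ℕ → RAMState → Prop := fun m s => s.reg 4 = ((L - i : ℕ) : ℤ) ∧
      ∃ cur price own, AuctionState s₀ L price own s ∧
      AuctionInv (fun l j => s₀.mem (matrixAddress L l j)) D L (L - i) cur price own ∧
      s.reg 5 = cur ∧ pot price = m
    have hpot : ∀ {cur price own}, AuctionInv (fun l j => s₀.mem (matrixAddress L l j)) D L
        (L - i) cur price own → 0 ≤ pot price ∧ pot price ≤ (L * (D + 1) : ℕ) := by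
      intro cur price own h
      refine ⟨Finset.sum_nonneg fun j hj => ?_, (Finset.sum_le_card_nsmul _ _ ((D : ℤ) + 1)
        fun j hj => ?_).trans ?_⟩
      · have := h.price_le j (by simpa using hj)
        omega
      · have := h.price_nonneg j (by simpa using hj)
        omega
      · simp
    have hs' : ∀ m : ℕ, pot price = m → I m (s.setReg 5 (s.reg 4 + s.reg 6)) := fun m hm => by
      refine ⟨by simp [h4], L - i, price, own, ?_, hinv', ?_, hm⟩
      · obtain ⟨hr, h6, h⟩ := hs
        exact ⟨fun r hr' => by simp [hr r hr', show r ≠ 5 by omega], by simp [h6], h⟩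
      · simp [h4, hs.2.1]
    obtain ⟨m, hm⟩ := Int.eq_ofNat_of_zero_le (hpot hinv').1
    have hmle := (hpot hinv').2
    refine (Triple.whilePos (b := 15 * L + 36) I ?_ (hs' m hm)).mono ?_ ?_
    · rintro m s ⟨h4, cur, price, own, hs, hinv, h5, hm⟩ hpos
      refine (triple_bidProg h0 h1 hA hs h5 (by omega) hinv).mono le_rfl ?_
      rintro s' ⟨h4', b, hb, hpb, hinv', hs', h5'⟩
      have hdec : pot (Function.update price b (price b + 1)) = pot price - 1 := by
        have hbm : b ∈ Finset.range L := by simpa using hb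
        simp only [pot]
        rw [← Finset.add_sum_erase _ _ hbm, ← Finset.add_sum_erase _
          (fun j => (D : ℤ) + 1 - price j) hbm, Function.update_self,
          Finset.sum_congr rfl fun j hj => by
            rw [Function.update_of_ne (Finset.ne_of_mem_erase hj)]]
        ring
      have h0' := (hpot hinv').1
      refine ⟨m - 1, by omega, by rw [h4', h4], own b, _, _, hs', hinv', h5', by omega⟩
    · have : m ≤ L * (D + 1) := by omega
      gcongr
    · rintro s' ⟨⟨m', h4', cur, price, own, hs', hinv', h5', -⟩, h5''⟩
      obtain rfl : cur = 0 := by omega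
      refine Triple.sub ⟨?_, price, own, ?_, ?_⟩
      · simp [h4', hs'.1 1, h1]
        omega
      · obtain ⟨hr, h6, h⟩ := hs'
        exact ⟨fun r hr' => by simp [hr r hr', show r ≠ 4 by omega], by simp [h6], h⟩
      · rwa [show L - (i + 1) + 1 = L - i by omega]
  · refine ⟨by simp [h0], fun _ => 0, fun _ => 0, ⟨fun r hr' => ?_, ?_, ?_, ?_, ?_⟩, ?_⟩
    · simp [show r ≠ 4 by omega, show r ≠ 6 by omega]
    · simp
    · simp
    -- Memory beyond the input is zero, which already reads as price `0` and owner nobody.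
    · exact fun j hj => hm _ (by omega)
    · exact fun j hj => hm _ (by omega)
    · exact AuctionInv.start
  · rintro s' ⟨-, price, own, hs, hinv⟩
    refine ⟨price, own, hs, by simpa using hinv⟩

end Auction

/-! ### Setting up the assignment problem -/

/-- Put `L (L + 1)` into `reg 2` and `(L + 1) ^ 2` into `reg 3`, where `L` is in `reg 0`. -/
def weightsProg : RAMProg :=
  .const 1 1 ⨟ .const 2 0 ⨟ .add 3 0 1 ⨟ .add 4 0 2 ⨟
  .whilePos 4 (.add 2 2 3 ⨟ .sub 4 4 1) ⨟ .add 3 3 2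

/-- Multiplication is replaced by adding `L + 1` to register `2` in `L` rounds; then `(L+1) + L(L+1)
= (L+1)^2`. -/
theorem triple_weightsProg {s : RAMState} {L : ℕ} (h0 : s.reg 0 = L) :
    Triple weightsProg s (3 * L + 10) fun s' => s'.mem = s.mem ∧ s'.reg 0 = L ∧ s'.reg 1 = 1 ∧
      s'.reg 2 = L * (L + 1) ∧ s'.reg 3 = (L + 1) * (L + 1) := by
  have hb0 : bitLength 0 = 1 := by simp [bitLength]
  have hb1 : bitLength 1 = 2 := by simp [bitLength]
  refine Triple.mono (b := bitLength 1 + (bitLength 0 + (1 + (1 + ((L + 1) * (2 + 1) + 1)))))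
    (Triple.seq_const (Triple.seq_const (Triple.seq_add (Triple.seq_add (Triple.seq
    ((Triple.whilePos_count L (fun i s' => s'.mem = s.mem ∧ s'.reg 0 = L ∧ s'.reg 1 = 1 ∧
      s'.reg 2 = i * (L + 1) ∧ s'.reg 3 = L + 1 ∧ s'.reg 4 = ((L - i : ℕ) : ℤ))
      (fun i _ s hs => hs.2.2.2.2.2) (fun i hi s' hs' => ?_) ?_).mono le_rfl ?_))))))
    (by rw [hb0, hb1]; omega) fun _ h => h
  · obtain ⟨hm, h0, h1, h2, h3, h4⟩ := hs'
    refine Triple.seq_add (b := 1) (Triple.sub ?_)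
    refine ⟨by simp [hm], by simp [h0], by simp [h1], ?_, by simp [h3], ?_⟩
    · simp [h2, h3]
      ring
    · simp [h4, h1]
      omega
  · simp [h0]
  · rintro s' ⟨hm, h0, h1, h2, h3, h4⟩
    refine Triple.add ?_
    simp [hm, h0, h1, h2, h3]
    ring

/-- Write `reg 2` into the memory cells of the diagonal entries of the matrix. -/
def diagonalProg : RAMProg :=
  .const 6 0 ⨟ .const 7 (-1) ⨟ .sub 7 7 0 ⨟ .add 8 0 1 ⨟ .add 4 0 6 ⨟
  .whilePos 4 (.store 7 2 ⨟ .sub 7 7 8 ⨟ .sub 4 4 1)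

/-- Bidders are numbered from `1` so that `0` can mean nobody; the diagonal thus pairs row `j + 1`
with column `j`, and its consecutive cells are `L + 1` apart. -/
theorem triple_diagonalProg {s : RAMState} {L : ℕ} (h0 : s.reg 0 = L) (h1 : s.reg 1 = 1)
    (hm : ∀ a < 0, s.mem a = 0) :
    Triple diagonalProg s (4 * L + 10) fun s' => (∀ r < 4, s'.reg r = s.reg r) ∧ s'.reg 6 = 0 ∧
      (∀ a ≥ 0, s'.mem a = s.mem a) ∧
      ∀ l, ∀ j < L, s'.mem (matrixAddress L l j) = if l = j + 1 then s.reg 2 else 0 := by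
  have hb0 : bitLength 0 = 1 := by simp [bitLength]
  have hb1 : bitLength (-1) = 2 := by simp [bitLength]
  refine Triple.mono (b := bitLength 0 + (bitLength (-1) + (1 + (1 + (1 + (L + 1) * (3 + 1))))))
    (Triple.seq_const (Triple.seq_const (Triple.seq_sub (Triple.seq_add (Triple.seq_add
    ((Triple.whilePos_count L (fun i s' => (∀ r < 4, s'.reg r = s.reg r) ∧ s'.reg 6 = 0 ∧
      (∀ a ≥ 0, s'.mem a = s.mem a) ∧ (∀ l, ∀ j < L, s'.mem (matrixAddress L l j) =
        if j < i ∧ l = j + 1 then s.reg 2 else 0) ∧ s'.reg 8 = L + 1 ∧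
      s'.reg 7 = matrixAddress L (i + 1) i ∧ s'.reg 4 = ((L - i : ℕ) : ℤ))
      (fun i _ s hs => hs.2.2.2.2.2.2) (fun i hi s' hs' => ?_) ?_).mono le_rfl ?_))))))
    (by rw [hb0, hb1]; omega) fun _ h => h
  · obtain ⟨hr, h6, hm, hM, h8, h7, h4⟩ := hs'
    refine Triple.seq_store (b := 2) (Triple.seq_sub (b := 1) (Triple.sub ?_))
    refine ⟨fun r hr' => ?_, by simp [h6], fun a ha => ?_, fun l j hj => ?_, by simp [h8], ?_, ?_⟩
    · simp [hr r hr', show r ≠ 4 by omega, show r ≠ 7 by omega]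
    · have := matrixAddress_neg L (i + 1) i
      simp [RAMState.setMem_mem, h7, hm a ha, show a ≠ matrixAddress L (i + 1) i by omega]
    · simp only [RAMState.setReg_mem, RAMState.setMem_mem, h7, matrixAddress_inj hj hi, hM l j hj,
        hr 2 (by omega)]
      grind
    · simp [h7, h8, matrixAddress]
      ring
    · simp [h4, hr, h1]
      omega
  · refine ⟨fun r hr' => ?_, by simp, by simp, fun l j hj => ?_, by simp [h0, h1], ?_, ?_⟩
    · simp [show r ≠ 4 by omega, show r ≠ 7 by omega, show r ≠ 8 by omega, show r ≠ 6 by omega]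
    · simp [hm _ (matrixAddress_neg L l j)]
    · simp [h0, matrixAddress]
    · simp [h0]
  · rintro s' ⟨hr, h6, hm, hM, -⟩
    refine ⟨hr, h6, hm, fun l j hj => ?_⟩
    simp [hM l j hj, hj]

/-- The node that stands for the grid point at the addresses `a` and `a + 1`. -/
def node (mem : ℤ → ℤ) (L a : ℕ) : ℕ := findIdx mem (mem a) (mem (a + 1)) L

/-- Write `reg 3` into the memory cells of those entries of the matrix that belong to cards. -/
def cardsProg : RAMProg :=
  .const 5 3 ⨟ .const 7 4 ⨟ .sub 4 0 5 ⨟ .whilePos 4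
    (.load 10 5 ⨟ .add 8 5 1 ⨟ .load 11 8 ⨟ findProg ⨟ .add 9 12 1 ⨟
      .add 8 8 1 ⨟ .load 10 8 ⨟ .add 8 8 1 ⨟ .load 11 8 ⨟ findProg ⨟
      .add 20 9 6 ⨟ .add 21 12 6 ⨟ addressProg ⨟ .store 22 3 ⨟ .add 5 8 1 ⨟ .sub 4 4 7)

open Classical in
theorem triple_cardsProg {s : RAMState} {L m : ℕ} (hL : L = 3 + 4 * m) (h0 : s.reg 0 = L)
    (h1 : s.reg 1 = 1) (h6 : s.reg 6 = 0) :
    Triple cardsProg s ((L + 1) * (35 * L + 58) + 10) fun s' =>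
      (∀ r < 4, s'.reg r = s.reg r) ∧ s'.reg 6 = 0 ∧ (∀ a ≥ 0, s'.mem a = s.mem a) ∧
      ∀ l, ∀ j < L, s'.mem (matrixAddress L l j) =
        if ∃ c < m, node s.mem L (3 + 4 * c) + 1 = l ∧ node s.mem L (5 + 4 * c) = j then s.reg 3
        else s.mem (matrixAddress L l j) := by
  have hb3 : bitLength 3 ≤ 4 := bitLength_natCast_le 3
  have hb4 : bitLength 4 ≤ 5 := bitLength_natCast_le 4
  refine Triple.mono (b := bitLength 3 + (bitLength 4 + (1 + (m + 1) * ((35 * L + 57) + 1))))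
    (Triple.seq_const (Triple.seq_const (Triple.seq_sub
    -- Cards start at address `3`, after `h`, `w`, `k`. The counter starts at `L - 3 = 4m` and loses
    -- four per card.
    ((Triple.whilePos_iterate m (fun i s' => (∀ r < 4, s'.reg r = s.reg r) ∧ s'.reg 6 = 0 ∧
      (∀ a ≥ 0, s'.mem a = s.mem a) ∧ (∀ l, ∀ j < L, s'.mem (matrixAddress L l j) =
        if ∃ c < i, node s.mem L (3 + 4 * c) + 1 = l ∧ node s.mem L (5 + 4 * c) = j then s.reg 3
        else s.mem (matrixAddress L l j)) ∧ s'.reg 7 = 4 ∧ s'.reg 5 = ((3 + 4 * i : ℕ) : ℤ) ∧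
        s'.reg 4 = 4 * (m - i))
      (fun i hi s hs => ?_) (fun i hi s₁ hs₁ => ?_) ?_).mono le_rfl ?_))))
    ?_ fun _ h => h
  · have h4 : s.reg 4 = 4 * ((m : ℤ) - i) := hs.2.2.2.2.2.2
    constructor <;> intro h <;> omega
  · obtain ⟨hr, h6, hm, hM, h7, h5, h4⟩ := hs₁
    refine Triple.mono (b := 1 + (1 + (1 + ((16 * L + 19) + (1 + (1 + (1 + (1 + (1 +
      ((16 * L + 19) + (1 + (1 + ((3 * L + 6) + (1 + (1 + 1)))))))))))))))
      (Triple.seq_load (Triple.seq_add (Triple.seq_load (Triple.seq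
      ((triple_findProg (L := L) (by simp [hr, h0]) (by simp [hr, h1])).mono le_rfl ?_)))))
      (by omega) fun _ h => h
    rintro s₂ ⟨hm₂, hr₂, h12⟩
    have hfind : ∀ p q, findIdx s₁.mem p q L = findIdx s.mem p q L :=
      fun p q => findIdx_congr hm p q L
    have hmem : ∀ a : ℕ, s₁.mem a = s.mem a := fun a => hm a (by omega)
    replace h12 : s₂.reg 12 = node s.mem L (3 + 4 * i) := by
      rw [h12]
      have e1 := hmem (3 + 4 * i)
      have e2 := hmem (3 + 4 * i + 1)
      simp only [Nat.cast_add, Nat.cast_one, Nat.cast_mul, Nat.cast_ofNat] at e1 e2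
      simp [hr, h1, h5, hfind, node, e1, e2]
    have h8₂ : s₂.reg 8 = ((4 + 4 * i : ℕ) : ℤ) := by
      simp [hr₂, h5, hr, h1]
      ring
    replace hr₂ : ∀ r < 8, s₂.reg r = s₁.reg r := fun r hr' => by
      rw [hr₂ r (by omega)]
      simp [show r ≠ 11 by omega, show r ≠ 8 by omega, show r ≠ 10 by omega]
    replace hm₂ : s₂.mem = s₁.mem := hm₂
    refine Triple.seq_add (Triple.seq_add (Triple.seq_load (Triple.seq_add (Triple.seq_load
      (Triple.seq ((triple_findProg (L := L) (by simp [hr₂, hr, h0])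
        (by simp [hr₂, hr, h1])).mono le_rfl ?_))))))
    rintro s₃ ⟨hm₃, hr₃, h12₃⟩
    replace h12₃ : s₃.reg 12 = node s.mem L (5 + 4 * i) := by
      rw [h12₃]
      have e1 := hmem (5 + 4 * i)
      have e2 := hmem (5 + 4 * i + 1)
      have e3 : (5 : ℤ) + 4 * i = 4 + 4 * i + 1 := by ring
      simp only [Nat.cast_add, Nat.cast_one, Nat.cast_mul, Nat.cast_ofNat, e3] at e1 e2
      simp [hr₂, hr, h1, h8₂, hm₂, hfind, node, e1, e2, e3]
    have h9₃ : s₃.reg 9 = ((node s.mem L (3 + 4 * i) + 1 : ℕ) : ℤ) := by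
      simp [hr₃, hr₂, hr, h1, h12]
    have h8₃ : s₃.reg 8 = ((6 + 4 * i : ℕ) : ℤ) := by
      simp [hr₃, hr₂, hr, h1, h8₂]
      ring
    replace hr₃ : ∀ r < 8, s₃.reg r = s₁.reg r := fun r hr' => by
      rw [hr₃ r (by omega)]
      simp [show r ≠ 11 by omega, show r ≠ 8 by omega, show r ≠ 10 by omega,
        show r ≠ 9 by omega, hr₂ r hr']
    replace hm₃ : s₃.mem = s₁.mem := by
      simpa [hm₂] using hm₃
    have hn1 : node s.mem L (3 + 4 * i) < L := findIdx_lt _ _ _ (by omega)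
    have hn2 : node s.mem L (5 + 4 * i) < L := findIdx_lt _ _ _ (by omega)
    refine Triple.seq_add (Triple.seq_add (Triple.seq ((triple_addressProg (L := L)
      (l := node s.mem L (3 + 4 * i) + 1) (j := node s.mem L (5 + 4 * i)) (by simp [hr₃, hr, h0])
      (by simp [hr₃, hr, h1]) (by simp [h9₃, hr₃, h6]) (by simp [h12₃, hr₃, h6])
      (by omega)).mono le_rfl ?_)))
    rintro s₄ ⟨hm₄, hr₄, h22⟩
    have h8₄ : s₄.reg 8 = ((6 + 4 * i : ℕ) : ℤ) := by
      simpa [h8₃] using hr₄ 8 (by omega)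
    replace hr₄ : ∀ r < 8, s₄.reg r = s₁.reg r := fun r hr' => by
      rw [hr₄ r (by omega)]
      simp [show r ≠ 20 by omega, show r ≠ 21 by omega, hr₃ r hr']
    replace hm₄ : s₄.mem = s₁.mem := by
      simpa [hm₃] using hm₄
    refine Triple.seq_store (Triple.seq_add (Triple.sub ?_))
    refine ⟨fun r hr' => ?_, by simp [hr₄, h6], fun a ha => ?_, fun l j hj => ?_,
      by simp [hr₄, h7], ?_, ?_⟩
    · simp [hr r hr', hr₄ r (by omega), show r ≠ 4 by omega, show r ≠ 5 by omega]
    · have := matrixAddress_neg L (node s.mem L (3 + 4 * i) + 1) (node s.mem L (5 + 4 * i))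
      simp only [RAMState.setReg_mem, RAMState.setMem_mem, h22, hm₄, hm a ha]
      rw [if_neg (by omega)]
    · simp only [RAMState.setReg_mem, RAMState.setMem_mem, h22, matrixAddress_inj hj hn2, hm₄,
        hM l j hj, hr₄ 3 (by omega), hr 3 (by omega)]
      by_cases hnew : l = node s.mem L (3 + 4 * i) + 1 ∧ j = node s.mem L (5 + 4 * i)
      · rw [if_pos hnew, if_pos ⟨i, by omega, hnew.1.symm, hnew.2.symm⟩]
      · rw [if_neg hnew]
        refine if_congr ⟨fun ⟨c, hc, h⟩ => ⟨c, by omega, h⟩, fun ⟨c, hc, h⟩ => ⟨c, ?_, h⟩⟩ rfl rfl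
        rcases Nat.lt_succ_iff_lt_or_eq.mp hc with hc | rfl
        · exact hc
        · exact absurd ⟨h.1.symm, h.2.symm⟩ hnew
    · simp [h8₄, hr₄, hr, h1]
      ring
    · simp [hr₄, h4, h7]
      ring
  · refine ⟨fun r hr' => ?_, by simp [h6], by simp, by simp, by simp, by simp, ?_⟩
    · simp [show r ≠ 4 by omega, show r ≠ 5 by omega, show r ≠ 7 by omega]
    · simp [h0, hL]
  · rintro s' ⟨hr, h6, hm, hM, -⟩
    exact ⟨hr, h6, hm, hM⟩
  · have : (m + 1) * ((35 * L + 57) + 1) ≤ (L + 1) * (35 * L + 58) := by gcongr; omega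
    omega

/-- Compare the value of the assignment with the value demanded by the input. -/
def answerProg : RAMProg :=
  .const 5 2 ⨟ .load 5 5 ⨟ .add 4 0 6 ⨟ .add 7 0 0 ⨟ .const 8 0 ⨟ .const 9 0 ⨟
  .whilePos 4 (.load 20 7 ⨟ .add 21 9 6 ⨟ addressProg ⨟ .load 10 22 ⨟ .add 8 8 10 ⨟ .sub 8 8 2 ⨟
    .sub 8 8 5 ⨟ .add 7 7 1 ⨟ .add 9 9 1 ⨟ .sub 4 4 1) ⨟
  .add 8 8 0 ⨟ .add 8 8 1 ⨟ .sub 8 8 5 ⨟ .ifPos 8 (.const 0 1) (.const 0 0)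

/-- Each of the `L` rounds subtracts `reg 2` and `k` (in cell `2`), and one more `k` is subtracted
at the end, so `(L+1)k` is formed without multiplication. -/
theorem triple_answerProg {s : RAMState} {L : ℕ} {own : ℕ → ℕ} (h0 : s.reg 0 = L)
    (h1 : s.reg 1 = 1) (h6 : s.reg 6 = 0) (ho : ∀ j < L, s.mem (L + L + j) = own j)
    (hle : ∀ j < L, own j ≤ L) :
    Triple answerProg s ((L + 1) * (3 * L + 16) + 16) fun s' => s'.reg 0 =
      if 0 < ∑ j ∈ Finset.range L, (s.mem (matrixAddress L (own j) j) - s.reg 2 - s.mem 2)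
        + L + 1 - s.mem 2 then 1 else 0 := by
  have hb0 : bitLength 0 = 1 := by simp [bitLength]
  have hb1 : bitLength 1 = 2 := by simp [bitLength]
  have hb2 : bitLength 2 ≤ 3 := bitLength_natCast_le 2
  refine Triple.mono (b := bitLength 2 + (1 + (1 + (1 + (bitLength 0 + (bitLength 0 +
    ((L + 1) * ((3 * L + 15) + 1) + (1 + (1 + (1 + (2 + 1))))))))))) (Triple.seq_const
    (Triple.seq_load (Triple.seq_add (Triple.seq_add (Triple.seq_const (Triple.seq_const
    (Triple.seq ((Triple.whilePos_count L (fun i s' => s'.mem = s.mem ∧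
      (∀ r < 4, s'.reg r = s.reg r) ∧ s'.reg 6 = 0 ∧ s'.reg 5 = s.mem 2 ∧ s'.reg 7 = L + L + i ∧
      s'.reg 9 = i ∧ s'.reg 8 = ∑ j ∈ Finset.range i,
        (s.mem (matrixAddress L (own j) j) - s.reg 2 - s.mem 2) ∧
      s'.reg 4 = ((L - i : ℕ) : ℤ))
      (fun i _ s hs => hs.2.2.2.2.2.2.2) (fun i hi s₁ hs₁ => ?_) ?_).mono le_rfl ?_))))))))
    (by
      have : (L + 1) * ((3 * L + 15) + 1) = (L + 1) * (3 * L + 16) := rfl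
      omega) fun _ h => h
  · obtain ⟨hm, hr, h6, h5, h7, h9, h8, h4⟩ := hs₁
    refine Triple.mono (b := 1 + (1 + ((3 * L + 6) + (1 + (1 + (1 + (1 + (1 + (1 + 1)))))))))
      (Triple.seq_load (Triple.seq_add (Triple.seq ((triple_addressProg (L := L) (l := own i)
      (j := i) (by simp [hr, h0]) (by simp [hr, h1]) (by simp [h7, hm, ho i hi]) (by simp [h9, h6])
      (hle i hi)).mono le_rfl ?_)))) (by omega) fun _ h => h
    rintro s₂ ⟨hm₂, hr₂, h22⟩
    replace hr₂ : ∀ r < 10, s₂.reg r = s₁.reg r := fun r hr' => by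
      rw [hr₂ r (by omega)]
      simp [show r ≠ 20 by omega, show r ≠ 21 by omega]
    replace hm₂ : s₂.mem = s.mem := by
      simpa [hm] using hm₂
    refine Triple.seq_load (Triple.seq_add (Triple.seq_sub (Triple.seq_sub (Triple.seq_add
      (Triple.seq_add (Triple.sub ?_))))))
    refine ⟨by simp [hm₂], fun r hr' => ?_, by simp [hr₂, h6], by simp [hr₂, h5], ?_, ?_, ?_, ?_⟩
    · simp [hr r hr', hr₂ r (by omega), show r ≠ 4 by omega, show r ≠ 9 by omega,
        show r ≠ 7 by omega, show r ≠ 8 by omega, show r ≠ 10 by omega]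
    · simp [hr₂, hr, h7, h1]
      ring
    · simp [hr₂, hr, h9, h1]
    · rw [Finset.sum_range_succ]
      simp [hr₂, hr, h8, h22, hm₂, h5]
      ring
    · simp [hr₂, hr, h4, h1]
      omega
  · refine ⟨by simp, fun r hr' => ?_, by simp [h6], by simp, by simp [h0], by simp, by simp, ?_⟩
    · simp [show r ≠ 4 by omega, show r ≠ 9 by omega,
        show r ≠ 7 by omega, show r ≠ 8 by omega, show r ≠ 5 by omega]
    · simp [h0, h6]
  · rintro s₁ ⟨hm, hr, h6, h5, h7, h9, h8, h4⟩
    refine Triple.seq_add (Triple.seq_add (Triple.seq_sub (Triple.ifPos (fun hpos => ?_)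
      fun hpos => ?_)))
    · simp [hr, h0, h1, h5, h8] at hpos
      refine (Triple.const ?_).mono (by rw [hb1]) fun _ h => h
      simp [hpos]
    · simp [hr, h0, h1, h5, h8] at hpos
      refine (Triple.const ?_).mono (by rw [hb0]; omega) fun _ h => h
      simp [hpos]

/-! ### Swishes as assignments -/

section Assignment

variable {h w : ℕ} (cards : Finset (SwishCard h w)) (g : GridPoint h w → ℕ) (L : ℕ)

open Classical in
/-- The benefit of the bidder `l` for the object `j`. -/
noncomputable def cardWeight (l j : ℕ) : ℤ :=
  if ∃ c ∈ cards, g c.1 + 1 = l ∧ g c.2 = j then (L + 1) * (L + 1)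
  else if l = j + 1 then L * (L + 1) else 0

variable {cards g L}

theorem cardWeight_nonneg (l j : ℕ) : 0 ≤ cardWeight cards g L l j := by
  unfold cardWeight
  split_ifs <;> positivity

theorem cardWeight_le (l j : ℕ) : cardWeight cards g L l j ≤ (L + 1) * (L + 1) := by
  unfold cardWeight
  split_ifs
  · exact le_rfl
  · nlinarith
  · positivity

theorem cardWeight_card {c : SwishCard h w} (hc : c ∈ cards) :
    cardWeight cards g L (g c.1 + 1) (g c.2) = (L + 1) * (L + 1) :=
  if_pos ⟨c, hc, rfl, rfl⟩

/-- Only an inequality, because a card with hoop and ball at the same point gives a diagonal entry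
the larger weight. -/
theorem le_cardWeight_diag (j : ℕ) : (L : ℤ) * (L + 1) ≤ cardWeight cards g L (j + 1) j := by
  unfold cardWeight
  rw [if_pos rfl]
  split_ifs
  · nlinarith
  · exact le_rfl

theorem cardWeight_eq_of_not {l j : ℕ} (hc : ¬ ∃ c ∈ cards, g c.1 + 1 = l ∧ g c.2 = j) :
    cardWeight cards g L l j ≤ L * (L + 1) := by
  unfold cardWeight
  rw [if_neg hc]
  split_ifs
  · exact le_rfl
  · positivity

theorem cardWeight_ne_zero {l j : ℕ} (h0 : cardWeight cards g L l j ≠ 0) :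
    (∃ c ∈ cards, g c.1 + 1 = l ∧ g c.2 = j) ∨ l = j + 1 := by
  unfold cardWeight at h0
  grind

open Classical in
-- Each card is counted once, in the column of its ball.
theorem sum_ball_eq_card {S : Finset (SwishCard h w)} (hlt : ∀ c ∈ S, g c.2 < L)
    (hinj : ∀ c ∈ S, ∀ d ∈ S, g c.2 = g d.2 → c = d) :
    (∑ j : Fin L, if ∃ c ∈ S, g c.2 = j then 1 else 0 : ℤ) = S.card := by
  rw [Finset.sum_boole, Int.natCast_inj]
  symm
  refine Finset.card_bij (fun c hc => ⟨g c.2, hlt c hc⟩) (fun c hc => ?_)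
    (fun c hc d hd hcd => hinj c hc d hd (congrArg Fin.val hcd)) fun j hj => ?_
  · rw [Finset.mem_filter]
    exact ⟨Finset.mem_univ _, c, hc, rfl⟩
  · obtain ⟨c, hc, hcj⟩ := (Finset.mem_filter.mp hj).2
    exact ⟨c, hc, Fin.ext hcj⟩

/-! ### From swishes to permutations and back -/

open Classical in
-- The permutation sends the ball of each card of `S` to its hoop and fixes all other nodes.
theorem exists_perm_of_isSwish (hlt : ∀ c ∈ cards, g c.1 < L ∧ g c.2 < L)
    (hinj : ∀ c ∈ cards, ∀ d ∈ cards, (g c.1 = g d.1 → c.1 = d.1) ∧ (g c.1 = g d.2 → c.1 = d.2) ∧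
      (g c.2 = g d.2 → c.2 = d.2))
    {S : Finset (SwishCard h w)} (hS : S ⊆ cards) (hsw : IsSwish S) :
    ∃ σ : Equiv.Perm (Fin L), (L : ℤ) * (L * (L + 1)) + (L + 1) * S.card ≤
      ∑ j, cardWeight cards g L (σ j + 1) j := by
  have hhoop : ∀ c ∈ S, ∀ d ∈ S, c.1 = d.1 → c = d := fun c hc d hd hcd => by
    rcases hsw c.1 with h0 | h1
    · exact absurd ⟨c, hc, rfl⟩ h0.1
    · exact h1.1.unique ⟨hc, rfl⟩ ⟨hd, hcd.symm⟩
  have hball : ∀ c ∈ S, ∀ d ∈ S, c.2 = d.2 → c = d := fun c hc d hd hcd => by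
    rcases hsw c.2 with h0 | h1
    · exact absurd ⟨c, hc, rfl⟩ h0.2
    · exact h1.2.unique ⟨hc, rfl⟩ ⟨hd, hcd.symm⟩
  have hball' : ∀ c ∈ S, ∃ d ∈ S, d.2 = c.1 := fun c hc => by
    rcases hsw c.1 with h0 | h1
    · exact absurd ⟨c, hc, rfl⟩ h0.1
    · exact h1.2.exists
  have hex : ∀ j : Fin L, ∃ i : Fin L, (∃ c ∈ S, g c.2 = j ∧ g c.1 = i) ∨
      ((¬ ∃ c ∈ S, g c.2 = j) ∧ i = j) := fun j => by
    by_cases hj : ∃ c ∈ S, g c.2 = j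
    · obtain ⟨c, hc, hcj⟩ := hj
      exact ⟨⟨g c.1, (hlt c (hS hc)).1⟩, Or.inl ⟨c, hc, hcj, rfl⟩⟩
    · exact ⟨j, Or.inr ⟨hj, rfl⟩⟩
  choose f hf using hex
  have hfinj : Function.Injective f := fun j j' hjj => by
    -- A moved node and a fixed node cannot have the same image: the image is a hoop of `S`, so it
    -- also carries a ball of `S` and is not fixed by default.
    have key : ∀ j j' : Fin L, f j = f j' → (∃ c ∈ S, g c.2 = j ∧ g c.1 = f j) →
        ¬ ((¬ ∃ c ∈ S, g c.2 = j') ∧ f j' = j') := by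
      rintro j j' hjj ⟨c, hc, hcj, hci⟩ ⟨hn, hj'⟩
      obtain ⟨d, hd, hdc⟩ := hball' c hc
      exact hn ⟨d, hd, by rw [hdc, hci, hjj, hj']⟩
    rcases hf j with h1 | h1 <;> rcases hf j' with h2 | h2
    · obtain ⟨c, hc, hcj, hci⟩ := h1
      obtain ⟨d, hd, hdj, hdi⟩ := h2
      have := hhoop c hc d hd ((hinj c (hS hc) d (hS hd)).1 (by rw [hci, hdi, hjj]))
      subst this
      exact Fin.ext (hcj.symm.trans hdj)
    · exact absurd h2 (key j j' hjj h1)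
    · exact absurd h1 (key j' j hjj.symm h2)
    · rw [← h1.2, ← h2.2, hjj]
  let σ : Equiv.Perm (Fin L) := Equiv.ofBijective f (Finite.injective_iff_bijective.mp hfinj)
  have hσ : ∀ j, σ j = f j := fun j => rfl
  refine ⟨σ, ?_⟩
  have hterm : ∀ j : Fin L, (L : ℤ) * (L + 1) + (L + 1) * (if ∃ c ∈ S, g c.2 = j then 1 else 0) ≤
      cardWeight cards g L (σ j + 1) j := fun j => by
    rw [hσ]
    rcases hf j with ⟨c, hc, hcj, hci⟩ | ⟨hn, hj⟩
    · rw [if_pos ⟨c, hc, hcj⟩, ← hcj, ← hci, cardWeight_card (hS hc)]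
      linarith
    · rw [if_neg hn, hj, mul_zero, add_zero]
      exact le_cardWeight_diag _
  have hcard := sum_ball_eq_card (fun c hc => (hlt c (hS hc)).2) fun c hc d hd hcd =>
    hball c hc d hd ((hinj c (hS hc) d (hS hd)).2.2 hcd)
  calc (L : ℤ) * (L * (L + 1)) + (L + 1) * S.card
      = ∑ j : Fin L, ((L : ℤ) * (L + 1) +
          (L + 1) * (if ∃ c ∈ S, g c.2 = j then 1 else 0)) := by
        rw [Finset.sum_add_distrib, Finset.sum_const, ← Finset.mul_sum, hcard]
        simp
    _ ≤ _ := Finset.sum_le_sum fun j _ => hterm j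

open Classical in
-- The swish consists of the cards whose entries `τ` uses. As `τ` uses no zero entry, following it
-- from a card leads to another card, or to a fixed point, where the card is a loop and serves
-- itself.
theorem exists_isSwish_of_perm (hlt : ∀ c ∈ cards, g c.1 < L ∧ g c.2 < L)
    (hinj : ∀ c ∈ cards, ∀ d ∈ cards, (g c.1 = g d.1 → c.1 = d.1) ∧ (g c.1 = g d.2 → c.1 = d.2) ∧
      (g c.2 = g d.2 → c.2 = d.2))
    (τ : Equiv.Perm (Fin L))
    (hτ : (L : ℤ) * (L * (L + 1)) < ∑ j, cardWeight cards g L (τ j + 1) j) :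
    ∃ S ⊆ cards, IsSwish S ∧ ∑ j, cardWeight cards g L (τ j + 1) j ≤
      (L : ℤ) * (L * (L + 1)) + (L + 1) * S.card := by
  -- One zero entry would leave at most `(L-1)(L+1)^2 = (L^2-1)(L+1)`, below the assumed weight.
  have hne : ∀ j, cardWeight cards g L (τ j + 1) j ≠ 0 := fun j hj => by
    have h1 : ∑ i, cardWeight cards g L (τ i + 1) i ≤
        ((Finset.univ : Finset (Fin L)).erase j).card • (((L : ℤ) + 1) * (L + 1)) := by
      rw [← Finset.add_sum_erase _ _ (Finset.mem_univ j), hj, zero_add]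
      exact Finset.sum_le_card_nsmul _ _ _ fun i _ => cardWeight_le _ _
    have hL := j.pos
    rw [Finset.card_erase_of_mem (Finset.mem_univ j), Finset.card_univ, Fintype.card_fin,
      nsmul_eq_mul, Nat.cast_sub (by omega)] at h1
    push_cast at h1
    nlinarith
  let S : Finset (SwishCard h w) := cards.filter fun c => ∃ j : Fin L, g c.2 = j ∧ g c.1 = τ j
  have hS : S ⊆ cards := Finset.filter_subset _ _
  have hmem : ∀ c, c ∈ S ↔ c ∈ cards ∧ ∃ j : Fin L, g c.2 = j ∧ g c.1 = τ j := fun c => by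
    simp [S]
  have huniq : ∀ c ∈ S, ∀ d ∈ S, (c.1 = d.1 ↔ c.2 = d.2) := fun c hc d hd => by
    obtain ⟨hc, i, hci, hci'⟩ := (hmem c).mp hc
    obtain ⟨hd, j, hdj, hdj'⟩ := (hmem d).mp hd
    constructor
    · intro hcd
      have : τ i = τ j := Fin.ext (by rw [← hci', ← hdj', hcd])
      exact (hinj c hc d hd).2.2 (by rw [hci, hdj, τ.injective this])
    · intro hcd
      have : i = j := Fin.ext (by rw [← hci, ← hdj, hcd])
      exact (hinj c hc d hd).1 (by rw [hci', hdj', this])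
  have hballs : ∀ c ∈ S, ∃ d ∈ S, d.2 = c.1 := fun c hc => by
    obtain ⟨hc', i, hci, hci'⟩ := (hmem c).mp hc
    rcases cardWeight_ne_zero (hne (τ i)) with ⟨d, hd, hd1, hd2⟩ | h0
    · exact ⟨d, (hmem d).mpr ⟨hd, τ i, hd2, by omega⟩,
        ((hinj c hc' d hd).2.1 (by rw [hci', hd2])).symm⟩
    -- The entry in column `τ i` is diagonal, so `τ` fixes `τ i`, hence also `i`: the hoop and the
    -- ball of `c` coincide.
    · have : i = τ i := (τ.injective (Fin.ext (by omega))).symm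
      refine ⟨c, hc, ((hinj c hc' c hc').2.1 ?_).symm⟩
      rw [hci, hci', ← this]
  have hhoops : ∀ c ∈ S, ∃ d ∈ S, d.1 = c.2 := fun c hc => by
    obtain ⟨hc', i, hci, hci'⟩ := (hmem c).mp hc
    rcases cardWeight_ne_zero (hne (τ.symm i)) with ⟨d, hd, hd1, hd2⟩ | h0
    · rw [Equiv.apply_symm_apply] at hd1
      exact ⟨d, (hmem d).mpr ⟨hd, τ.symm i, hd2, by rw [Equiv.apply_symm_apply]; omega⟩,
        (hinj d hd c hc').2.1 (by omega)⟩
    · rw [Equiv.apply_symm_apply] at h0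
      have : i = τ i := by
        nth_rw 2 [show i = τ.symm i from Fin.ext (by omega)]
        rw [Equiv.apply_symm_apply]
      refine ⟨c, hc, (hinj c hc' c hc').2.1 ?_⟩
      rw [hci, hci', ← this]
  refine ⟨S, hS, fun p => ?_, ?_⟩
  · by_cases hp : ∃ c ∈ S, c.1 = p
    · obtain ⟨c, hc, rfl⟩ := hp
      obtain ⟨d, hd, hdc⟩ := hballs c hc
      exact Or.inr ⟨⟨c, ⟨hc, rfl⟩, fun e he => Prod.ext he.2 ((huniq e he.1 c hc).mp he.2)⟩,
        ⟨d, ⟨hd, hdc⟩, fun e he => Prod.ext ((huniq e he.1 d hd).mpr (he.2.trans hdc.symm))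
          (he.2.trans hdc.symm)⟩⟩
    · refine Or.inl ⟨hp, ?_⟩
      rintro ⟨c, hc, rfl⟩
      exact hp (hhoops c hc)
  · have hterm : ∀ j : Fin L, cardWeight cards g L (τ j + 1) j ≤ (L : ℤ) * (L + 1) +
        (L + 1) * (if ∃ c ∈ S, g c.2 = j then 1 else 0) := fun j => by
      by_cases hj : ∃ c ∈ cards, g c.1 + 1 = τ j + 1 ∧ g c.2 = j
      · obtain ⟨c, hc, hc1, hc2⟩ := hj
        rw [if_pos ⟨c, (hmem c).mpr ⟨hc, j, hc2, by omega⟩, hc2⟩]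
        have := cardWeight_le (cards := cards) (g := g) (L := L) (τ j + 1) j
        linarith
      · refine (cardWeight_eq_of_not hj).trans (le_add_of_nonneg_right ?_)
        split_ifs <;> positivity
    have hcard := sum_ball_eq_card (fun c hc => (hlt c (hS hc)).2) fun c hc d hd hcd => by
      have h2 := (hinj c (hS hc) d (hS hd)).2.2 hcd
      exact Prod.ext ((huniq c hc d hd).mpr h2) h2
    calc _ ≤ ∑ j : Fin L, ((L : ℤ) * (L + 1) +
          (L + 1) * (if ∃ c ∈ S, g c.2 = j then 1 else 0)) := Finset.sum_le_sum fun j _ => hterm j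
      _ = _ := by
        rw [Finset.sum_add_distrib, Finset.sum_const, ← Finset.mul_sum, hcard]
        simp

end Assignment

/-! ### Correctness on encoded instances -/

theorem getD_flatMap_encodeCard {h w : ℕ} (l : List (SwishCard h w)) (c r : ℕ) (hc : c < l.length)
    (hr : r < 4) : (l.flatMap SwishInstance.encodeCard).getD (4 * c + r) 0 =
      (SwishInstance.encodeCard l[c]).getD r 0 := by
  induction l generalizing c with
  | nil => simp at hc
  | cons a l ih =>
    have hlen : (SwishInstance.encodeCard a).length = 4 := rfl
    rw [List.flatMap_cons]
    rcases c with _ | c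
    · rw [List.getD_append _ _ _ _ (by rw [hlen]; omega)]
      simp
    · rw [List.getD_append_right _ _ _ _ (by rw [hlen]; omega), hlen,
        show 4 * (c + 1) + r - 4 = 4 * c + r by omega, ih c (by simpa using hc)]
      simp

theorem length_flatMap_encodeCard {h w : ℕ} (l : List (SwishCard h w)) :
    (l.flatMap SwishInstance.encodeCard).length = 4 * l.length := by
  induction l with
  | nil => rfl
  | cons a l ih =>
    rw [List.flatMap_cons, List.length_append, ih, List.length_cons]
    simp [SwishInstance.encodeCard]
    ring

namespace SwishInstance

variable (I : SwishInstance)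

theorem length_encode : I.encode.length = 3 + 4 * I.cards.length := by
  rw [encode, List.length_append, length_flatMap_encodeCard]
  rfl

theorem init_mem_two : (RAMState.init I.encode).mem 2 = I.k := by
  simp [RAMState.init, encode]

theorem init_mem_card {c : ℕ} (hc : c < I.cards.length) (r : ℕ) (hr : r < 4) :
    (RAMState.init I.encode).mem (3 + 4 * c + r : ℕ) = (encodeCard I.cards[c]).getD r 0 := by
  rw [← getD_flatMap_encodeCard I.cards c r hc hr]
  simp only [RAMState.init, Int.natCast_nonneg, if_true, Int.toNat_natCast, encode]
  rw [List.getD_append_right _ _ _ _ (by simp; omega)]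
  congr 1
  simp
  omega

/-- The node that stands for the grid point `p`. -/
def pointNode (p : GridPoint I.h I.w) : ℕ :=
  findIdx (RAMState.init I.encode).mem ((p.1 : ℤ) + 1) ((p.2 : ℤ) + 1) I.encode.length

theorem init_mem_hoop {c : ℕ} (hc : c < I.cards.length) :
    (RAMState.init I.encode).mem (3 + 4 * c : ℕ) = (I.cards[c].1.1 : ℤ) + 1 ∧
      (RAMState.init I.encode).mem ((3 + 4 * c : ℕ) + 1) = (I.cards[c].1.2 : ℤ) + 1 :=
  ⟨I.init_mem_card hc 0 (by omega), I.init_mem_card hc 1 (by omega)⟩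

theorem init_mem_ball {c : ℕ} (hc : c < I.cards.length) :
    (RAMState.init I.encode).mem (5 + 4 * c : ℕ) = (I.cards[c].2.1 : ℤ) + 1 ∧
      (RAMState.init I.encode).mem ((5 + 4 * c : ℕ) + 1) = (I.cards[c].2.2 : ℤ) + 1 := by
  have h2 := I.init_mem_card hc 2 (by omega)
  have h3 := I.init_mem_card hc 3 (by omega)
  rw [show 3 + 4 * c + 2 = 5 + 4 * c by omega] at h2
  rw [show 3 + 4 * c + 3 = 5 + 4 * c + 1 by omega] at h3
  exact ⟨h2, h3⟩

theorem node_hoop {c : ℕ} (hc : c < I.cards.length) :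
    node (RAMState.init I.encode).mem I.encode.length (3 + 4 * c) =
      I.pointNode I.cards[c].1 := by
  rw [node, (I.init_mem_hoop hc).1, (I.init_mem_hoop hc).2, pointNode]

theorem node_ball {c : ℕ} (hc : c < I.cards.length) :
    node (RAMState.init I.encode).mem I.encode.length (5 + 4 * c) =
      I.pointNode I.cards[c].2 := by
  rw [node, (I.init_mem_ball hc).1, (I.init_mem_ball hc).2, pointNode]

theorem pointNode_lt (p : GridPoint I.h I.w) : I.pointNode p < I.encode.length :=
  findIdx_lt _ _ _ (by rw [length_encode]; omega)

/-- The grid point `p` can be recovered from its node. -/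
def IsListed (p : GridPoint I.h I.w) : Prop :=
  (RAMState.init I.encode).mem (I.pointNode p) = (p.1 : ℤ) + 1 ∧
    (RAMState.init I.encode).mem (I.pointNode p + 1) = (p.2 : ℤ) + 1

variable {I}

theorem IsListed.eq_of_pointNode_eq {p q : GridPoint I.h I.w} (hp : I.IsListed p)
    (hq : I.IsListed q) (h : I.pointNode p = I.pointNode q) : p = q := by
  rw [IsListed, h] at hp
  have h1 := hp.1.symm.trans hq.1
  have h2 := hp.2.symm.trans hq.2
  exact Prod.ext (Fin.ext (by omega)) (Fin.ext (by omega))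

theorem isListed_of_mem {c : SwishCard I.h I.w} (hc : c ∈ I.cards) :
    I.IsListed c.1 ∧ I.IsListed c.2 := by
  obtain ⟨i, hi, rfl⟩ := List.mem_iff_getElem.mp hc
  have hL := I.length_encode
  exact ⟨(findIdx_spec (by omega) (I.init_mem_hoop hi).1 (I.init_mem_hoop hi).2).2,
    (findIdx_spec (by omega) (I.init_mem_ball hi).1 (I.init_mem_ball hi).2).2⟩

theorem pointNode_inj : ∀ c ∈ I.cards.toFinset, ∀ d ∈ I.cards.toFinset,
    (I.pointNode c.1 = I.pointNode d.1 → c.1 = d.1) ∧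
    (I.pointNode c.1 = I.pointNode d.2 → c.1 = d.2) ∧
    (I.pointNode c.2 = I.pointNode d.2 → c.2 = d.2) := fun c hc d hd => by
  have hc' := isListed_of_mem (List.mem_toFinset.mp hc)
  have hd' := isListed_of_mem (List.mem_toFinset.mp hd)
  exact ⟨hc'.1.eq_of_pointNode_eq hd'.1, hc'.1.eq_of_pointNode_eq hd'.2,
    hc'.2.eq_of_pointNode_eq hd'.2⟩

/-- A nearly optimal assignment decides the instance. -/
theorem hasLargeSwish_iff {L : ℕ} (hL : L = I.encode.length) (τ : Equiv.Perm (Fin L))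
    (hτ : ∀ σ : Equiv.Perm (Fin L),
      ∑ j, cardWeight I.cards.toFinset I.pointNode L (σ j + 1) j ≤
        ∑ j, cardWeight I.cards.toFinset I.pointNode L (τ j + 1) j + L) :
    I.HasLargeSwish ↔ 0 < ∑ j : Fin L, (cardWeight I.cards.toFinset I.pointNode L (τ j + 1) j
      - L * (L + 1) - I.k) + L + 1 - I.k := by
  have hlt : ∀ c ∈ I.cards.toFinset, I.pointNode c.1 < L ∧ I.pointNode c.2 < L :=
    fun c _ => by rw [hL]; exact ⟨I.pointNode_lt _, I.pointNode_lt _⟩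
  simp only [Finset.sum_sub_distrib, Finset.sum_const, Finset.card_univ, Fintype.card_fin,
    nsmul_eq_mul]
  set T := ∑ j, cardWeight I.cards.toFinset I.pointNode L (τ j + 1) j
  constructor
  · rintro ⟨S, hS, hsw, hk⟩
    obtain ⟨σ, hσ⟩ := exists_perm_of_isSwish hlt pointNode_inj hS hsw
    -- With `|S| ≥ k` the weight of `τ` is at least `L^2(L+1) + (L+1)k - L`; the added `L + 1` makes
    -- the tested quantity positive.
    have h1 := hτ σ
    nlinarith
  · intro hpos
    -- For `k ≤ 0` the empty swish suffices. For `k ≥ 1` positivity forces the weight above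
    -- `L^2(L+1)`, as the passage from `τ` to a swish requires.
    rcases le_or_gt I.k 0 with hk | hk
    · refine ⟨∅, Finset.empty_subset _, fun p => Or.inl ⟨by simp, by simp⟩, by simpa using hk⟩
    · obtain ⟨S, hS, hsw, hle⟩ := exists_isSwish_of_perm hlt pointNode_inj τ (by nlinarith)
      refine ⟨S, hS, hsw, ?_⟩
      -- Dividing by `L + 1` leaves the integer inequality `k - 1 < |S|`, which is `k ≤ |S|`.
      have : ((L : ℤ) + 1) * (I.k - S.card - 1) < 0 := by linarith
      have := neg_of_mul_neg_right this (by positivity)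
      omega

end SwishInstance

/-! ### The complete program and its logarithmic cost -/

/-- The program deciding the problem. -/
def swishProg : RAMProg :=
  weightsProg ⨟ diagonalProg ⨟ cardsProg ⨟ auctionProg ⨟ answerProg

open Polynomial in
/-- The number of steps of `swishProg`. -/
noncomputable def swishSteps : Polynomial ℕ :=
  (3 * X + 10) + ((4 * X + 10) + (((X + 1) * (35 * X + 58) + 10) +
    ((2 + (X + 1) * ((X * ((X + 1) * (X + 1) + 1) + 1) * (15 * X + 37) + 3)) +
      ((X + 1) * (3 * X + 16) + 16))))

open Classical in
theorem triple_swishProg (I : SwishInstance) :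
    Triple swishProg (RAMState.init I.encode) (swishSteps.eval I.encode.length) fun s =>
      s.reg 0 = if I.HasLargeSwish then 1 else 0 := by
  obtain ⟨L, hL⟩ : ∃ L, L = I.encode.length := ⟨_, rfl⟩
  have hLm : L = 3 + 4 * I.cards.length := by rw [hL, I.length_encode]
  rw [← hL]
  have hinit : ∀ a, (a < 0 ∨ (L : ℤ) ≤ a) → (RAMState.init I.encode).mem a = 0 := by
    intro a ha
    simp only [RAMState.init]
    split_ifs with h
    · exact List.getD_eq_default _ _ (by omega)
    · rfl
  have hg : ∀ p, I.pointNode p < L := fun p => by rw [hL]; exact I.pointNode_lt p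
  refine Triple.mono (b := (3 * L + 10) + ((4 * L + 10) + (((L + 1) * (35 * L + 58) + 10) +
    ((2 + (L + 1) * ((L * ((L + 1) * (L + 1) + 1) + 1) * (15 * L + 37) + 3)) +
      ((L + 1) * (3 * L + 16) + 16))))) (Triple.seq ((triple_weightsProg (L := L)
      (by simp [RAMState.init, hL])).mono le_rfl ?_)) (by simp [swishSteps]) fun _ h => h
  rintro s₁ ⟨hm₁, h0₁, h1₁, h2₁, h3₁⟩
  refine Triple.seq ((triple_diagonalProg h0₁ h1₁
    (fun a ha => by rw [hm₁, hinit a (Or.inl ha)])).mono le_rfl ?_)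
  rintro s₂ ⟨hr₂, h6₂, hm₂, hM₂⟩
  rw [hm₁] at hm₂
  refine Triple.seq ((triple_cardsProg hLm (by rw [hr₂ 0 (by omega), h0₁])
    (by rw [hr₂ 1 (by omega), h1₁]) h6₂).mono le_rfl ?_)
  rintro s₃ ⟨hr₃, h6₃, hm₃, hM₃⟩
  have hr : ∀ r < 4, s₃.reg r = s₁.reg r := fun r hr => by rw [hr₃ r hr, hr₂ r hr]
  have hm : ∀ a ≥ 0, s₃.mem a = (RAMState.init I.encode).mem a := fun a ha => by
    rw [hm₃ a ha, hm₂ a ha]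
  have hnode : ∀ a : ℕ, node s₂.mem L a = node (RAMState.init I.encode).mem L a := fun a => by
    rw [node, node, findIdx_congr hm₂, hm₂ _ (by omega), hm₂ _ (by omega)]
  have hM : ∀ l, ∀ j < L, s₃.mem (matrixAddress L l j) =
      cardWeight I.cards.toFinset I.pointNode L l j := fun l j hj => by
    rw [hM₃ l j hj, hr₂ 3 (by omega), h3₁, hM₂ l j hj, h2₁, cardWeight]
    refine if_congr ⟨?_, ?_⟩ rfl rfl
    · rintro ⟨c, hc, h1, h2⟩
      rw [hnode, hL, I.node_hoop hc] at h1
      rw [hnode, hL, I.node_ball hc] at h2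
      exact ⟨I.cards[c], by simp, h1, h2⟩
    · rintro ⟨c, hc, h1, h2⟩
      obtain ⟨i, hi, rfl⟩ := List.mem_iff_getElem.mp (List.mem_toFinset.mp hc)
      refine ⟨i, hi, ?_, ?_⟩
      · rwa [hnode, hL, I.node_hoop hi]
      · rwa [hnode, hL, I.node_ball hi]
  have h0₃ : s₃.reg 0 = L := by rw [hr 0 (by omega), h0₁]
  have h1₃ : s₃.reg 1 = 1 := by rw [hr 1 (by omega), h1₁]
  refine Triple.seq ((triple_auctionProg (D := (L + 1) * (L + 1)) h0₃ h1₃ (fun l _ j hj => ?_)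
    (fun a ha => by rw [hm a (by omega), hinit a (Or.inr ha)])).mono le_rfl ?_)
  · rw [hM l j hj]
    exact ⟨cardWeight_nonneg l j, by push_cast; exact cardWeight_le l j⟩
  rintro s₄ ⟨price, own, ⟨hr₄, h6₄, hm₄, -, ho₄⟩, hinv⟩
  refine (triple_answerProg (by rw [hr₄ 0 (by omega), h0₃]) (by rw [hr₄ 1 (by omega), h1₃]) h6₄
    ho₄ hinv.own_le).mono le_rfl fun s' hs' => ?_
  obtain ⟨τ, hτ, hopt⟩ := hinv.exists_perm
  simp only [hM _ _ (Fin.is_lt _)] at hopt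
  have hk : s₄.mem 2 = I.k := by rw [hm₄ 2 (by omega), hm 2 (by omega), I.init_mem_two]
  have h2 : s₄.reg 2 = L * (L + 1) := by rw [hr₄ 2 (by omega), hr 2 (by omega), h2₁]
  have hsum : ∑ j ∈ Finset.range L, (s₄.mem (matrixAddress L (own j) j) - s₄.reg 2 - s₄.mem 2) =
      ∑ j : Fin L, (cardWeight I.cards.toFinset I.pointNode L (τ j + 1) j
        - L * (L + 1) - I.k) := by
    rw [Finset.sum_range]
    refine Finset.sum_congr rfl fun j _ => ?_
    have := matrixAddress_neg L (own j) j
    rw [hm₄ _ (by omega), hM _ _ j.is_lt, hτ, h2, hk]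
  rw [hs', hsum, hk]
  exact if_congr (SwishInstance.hasLargeSwish_iff hL τ hopt).symm rfl rfl

theorem length_le_inputSize (x : List ℤ) : x.length ≤ inputSize x := by
  unfold inputSize
  induction x with
  | nil => simp
  | cons a x ih =>
    have := bitLength_pos a
    simp only [List.map_cons, List.sum_cons, List.length_cons]
    omega

/-- The extra `1` is for register `0`, which holds the length of the list rather than one of its
entries. -/
theorem bounded_init (x : List ℤ) : (RAMState.init x).Bounded (inputSize x + 1) := by
  have hb0 : bitLength 0 = 1 := by simp [bitLength]
  constructor
  · intro r
    simp only [RAMState.init]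
    split_ifs
    · exact (bitLength_natCast_le _).trans (Nat.add_le_add_right (length_le_inputSize x) 1)
    · omega
  · intro a
    simp only [RAMState.init]
    split_ifs
    · rcases lt_or_ge a.toNat x.length with h | h
      · rw [List.getD_eq_getElem _ _ h]
        refine Nat.le_succ_of_le (List.single_le_sum (fun _ _ => Nat.zero_le _) _ ?_)
        exact List.mem_map_of_mem (List.getElem_mem h)
      · rw [List.getD_eq_default _ _ h]
        omega
    · omega

theorem theorem1 :
    SolvableInPolyTime SwishInstance.encode SwishInstance.HasLargeSwish := by
  classical
  -- This is the bound `b * (2 * (M + b))` of `Triple` with `M = inputSize + 1` and `b` the number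
  -- of steps.
  refine ⟨swishProg, swishSteps * (2 * (Polynomial.X + 1 + swishSteps)), fun I => ?_⟩
  obtain ⟨t, s, hexec, hs, hcost⟩ := triple_swishProg I
  refine ⟨t, s, hexec, (hcost _ (bounded_init _)).2.trans ?_, fun h => ?_, fun h => ?_⟩
  -- Steps are counted in terms of the list length, which is at most the input size since every
  -- entry has positive length.
  · have hmono : swishSteps.eval I.encode.length ≤ swishSteps.eval (inputSize I.encode) := by
      have := length_le_inputSize I.encode
      simp only [swishSteps, Polynomial.eval_add, Polynomial.eval_mul, Polynomial.eval_X,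
        Polynomial.eval_one, Polynomial.eval_ofNat]
      gcongr
    simp only [Polynomial.eval_add, Polynomial.eval_mul, Polynomial.eval_X,
      Polynomial.eval_one, Polynomial.eval_ofNat]
    gcongr
  · rw [hs, if_pos h]
  · rw [hs, if_neg h]
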